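/- Let $\mathbb T=\mathbb R/2\pi\mathbb Z$ be the torus with Lebesgue measure $|\cdot|$ (so $|\mathbb T|=2\pi$). For $m\ge 0$ let $\mathcal F_m$ be the set of trigonometric polynomials $f(t)=\frac{a_0}{2}+\sum_{k=1}^{m}(a_k\cos kt+b_k\sin kt)$ with real coefficients. For an integer $n\ge 1$ and a compact set $Q\subset\mathbb T$ put $$U_n(Q)=\inf_{f\in\mathcal F_{n-1}}\ \max_{t\in Q}|\cos nt-f(t)|,$$ and for $0<\alpha<\pi$ put $U_n(2\alpha)=\inf\{U_n(Q): Q\subset\mathbb T \text{ compact},\ |Q|=2\alpha\}$. Theorem. Let $n\ge 1$ and $0<\alpha<\pi$. For every compact set $Q\subset\mathbb T$ with $|Q|=2\alpha$, $$U_n(Q)\ge \sin^{2n}\frac{\alpha}{2},$$ and equality holds if and only if $Q$ is (the image in $\mathbb T$ of) one of the segments $\left[-\alpha+\frac{k\pi}{n},\ \alpha+\frac{k\pi}{n}\right]$, $k\in\mathbb Z$. Consequently, $$U_n(2\alpha)=\sin^{2n}\frac{\alpha}{2}.$$ -/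

import Mathlib

open MeasureTheory

noncomputable section

instance factTwoPiPos : Fact (0 < 2 * Real.pi) := ⟨Real.two_pi_pos⟩

/-- The torus: the real line modulo `2π`. Its `volume` is Lebesgue measure, of total mass `2π`. -/
abbrev Torus : Type := AddCircle (2 * Real.pi)

/-- The harmonic `cos kt` as a function on the torus. -/
def cosHarmonic (k : ℕ) (t : Torus) : ℝ := Real.cos_periodic.lift (k • t)

/-- The harmonic `sin kt` as a function on the torus. -/
def sinHarmonic (k : ℕ) (t : Torus) : ℝ := Real.sin_periodic.lift (k • t)

theorem cosHarmonic_coe (k : ℕ) (x : ℝ) : cosHarmonic k (x : Torus) = Real.cos (k * x) := by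
  rw [cosHarmonic, ← AddCircle.coe_nsmul, Function.Periodic.lift_coe, nsmul_eq_mul]

theorem sinHarmonic_coe (k : ℕ) (x : ℝ) : sinHarmonic k (x : Torus) = Real.sin (k * x) := by
  rw [sinHarmonic, ← AddCircle.coe_nsmul, Function.Periodic.lift_coe, nsmul_eq_mul]

/-- Real trigonometric polynomials of order (at most) `m` on the torus. -/
def trigPoly (m : ℕ) : Set (Torus → ℝ) :=
  {f | ∃ a b : ℕ → ℝ, ∀ t, f t = a 0 / 2 +
    ∑ k ∈ Finset.Icc 1 m, (a k * cosHarmonic k t + b k * sinHarmonic k t)}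

/-- The uniform norm on `Q` (used for continuous functions and compact `Q`). -/
def uniformNormOn (Q : Set Torus) (f : Torus → ℝ) : ℝ := ⨆ t : Q, |f t|

/-- The best uniform approximation on `Q` of `cos nt` by trigonometric polynomials of
order `n - 1`, for `n ≥ 1`. -/
def bestApprox (n : ℕ) (Q : Set Torus) : ℝ :=
  sInf ((fun f : Torus → ℝ => uniformNormOn Q (fun t => cosHarmonic n t - f t)) ''
    trigPoly (n - 1))

/-- The infimum of `bestApprox n Q` over all compact subsets `Q` of the torus of measure `s`. -/
def leastBestApprox (n : ℕ) (s : ℝ) : ℝ :=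
  sInf (bestApprox n '' {Q : Set Torus | IsCompact Q ∧ volume Q = ENNReal.ofReal s})

/-- The segment `[-α + kπ/n, α + kπ/n]`, regarded as a subset of the torus. -/
def torusSegment (n : ℕ) (α : ℝ) (k : ℤ) : Set Torus :=
  (fun x : ℝ => (x : Torus)) '' Set.Icc (-α + k * Real.pi / n) (α + k * Real.pi / n)

end

/-! Lower bound. Let F = cos nt - f with |F| ≤ M on Q. With z = e^{it}, P = 2zⁿF extends to a
polynomial of degree 2n with P(0) = 1. The roots η = zⁿX of η² - Pη + (Mzⁿ)² = 0, where X + M²/X =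
2F, form a two-valued analytic function. Over E = `unitPoint '' Q` both values have modulus M,
because |F| ≤ M there, and at 0 one of them is 1. The growth |z|^{2n} at infinity is compensated by
B^{2n}, where B = `diskMap Q α` is analytic off E, |B| ≤ 1, B vanishes at infinity and |B(0)| =
sin(α/2). The maximum principle `norm_root_mul_pow_le` gives |η| |B|^{2n} ≤ M, and z = 0, η = 1
gives the bound.

Construction of B. The Herglotz integral h of the indicator of Q satisfies |Re h| ≤ 2π, h(0) = 2α
and h(∞) = -2α. So exp(ih/4) lies in the closed right half-plane, and a Möbius map to the disk sends
its value e^{-iα/2} at infinity to 0. Only the measure of Q enters B(0).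

Equality. Then ηB^{2n} is constant along the branch with η(0) = 1, and the quadratic equation
becomes an identity between P and B up to the circle off Q (`circle_identity_of_eq`). There it fixes
the phase of B: on a gap of Q, u = B²/|B|² equals ωe^{-ix} with ω constant. At the ends of a gap u
can only be 1 or e^{-2iα}, which forces the length 2π - 2α and quantizes the position (`gap_of_eq`).
So Q lies in an arc of length 2α, and being closed of measure 2α it fills it.

Sharpness. On a segment the error s^{2n} Tₙ((cos(t - c) - cos²(α/2))/s²), with s = sin(α/2) and c =
kπ/n, attains the bound (`exists_trigPoly_le_of_torusSegment`). -/

noncomputable section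

/-! ### Maximum principle for the two-valued root of a quadratic. -/

open Filter Topology in
/-- A simple root of `η² - P(z) η + δ(z)²` continues analytically. -/
theorem exists_analyticAt_root {P δ : ℂ → ℂ} {z₀ η₀ : ℂ} (hP : AnalyticAt ℂ P z₀)
    (hδ : AnalyticAt ℂ δ z₀) (hroot : η₀ ^ 2 - P z₀ * η₀ + δ z₀ ^ 2 = 0)
    (hs : 2 * η₀ ≠ P z₀) :
    ∃ r : ℂ → ℂ, AnalyticAt ℂ r z₀ ∧ r z₀ = η₀ ∧
      ∀ᶠ z in 𝓝 z₀, r z ^ 2 - P z * r z + δ z ^ 2 = 0 := by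
  set D : ℂ → ℂ := fun z => P z ^ 2 - 4 * δ z ^ 2 with hD
  have hD0 : D z₀ = (2 * η₀ - P z₀) ^ 2 := by
    simp only [hD]; linear_combination (-4) * hroot
  have hne : D z₀ ≠ 0 := by rw [hD0]; exact pow_ne_zero 2 (sub_ne_zero.2 hs)
  have hDan : AnalyticAt ℂ D z₀ := by fun_prop
  have hq : AnalyticAt ℂ (fun z => D z / D z₀) z₀ := hDan.div_const
  -- Normalizing the discriminant to be 1 at z₀ puts it in the domain of the principal logarithm,
  -- which supplies an analytic square root.
  have hq0 : D z₀ / D z₀ ∈ Complex.slitPlane := by rw [div_self hne]; simp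
  have hlog : AnalyticAt ℂ (fun z => Complex.log (D z / D z₀)) z₀ := hq.clog hq0
  refine ⟨fun z => (P z + (2 * η₀ - P z₀) * Complex.exp (Complex.log (D z / D z₀) / 2)) / 2,
    by fun_prop, ?_, ?_⟩
  · simp [div_self hne]
  · have hev : ∀ᶠ z in 𝓝 z₀, D z / D z₀ ≠ 0 :=
      hq.continuousAt.eventually_ne (by rw [div_self hne]; exact one_ne_zero)
    filter_upwards [hev] with z hz
    have he : Complex.exp (Complex.log (D z / D z₀) / 2) ^ 2 = D z / D z₀ := by
      rw [← Complex.exp_nat_mul]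
      push_cast
      rw [mul_div_cancel₀ _ (two_ne_zero), Complex.exp_log hz]
    have h2 : ((2 * η₀ - P z₀) * Complex.exp (Complex.log (D z / D z₀) / 2)) ^ 2 = D z := by
      rw [mul_pow, he, ← hD0]; field_simp
    have h3 : D z = P z ^ 2 - 4 * δ z ^ 2 := rfl
    linear_combination (1 / 4) * h2 + (1 / 4) * h3

/-- A quadratic `η² - p η + d` over `ℂ` factors. -/
theorem exists_root_pair (p d : ℂ) :
    ∃ a b : ℂ, a + b = p ∧ a * b = d := by
  obtain ⟨s, hs⟩ := IsAlgClosed.exists_pow_nat_eq (p ^ 2 - 4 * d) two_pos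
  refine ⟨(p + s) / 2, (p - s) / 2, by ring, ?_⟩
  linear_combination (-1 / 4) * hs

/-- A root of `η² - p η + δ²` of modulus at least `|δ|`. -/
theorem exists_root_norm_ge (p δ : ℂ) : ∃ η : ℂ, η ^ 2 - p * η + δ ^ 2 = 0 ∧ ‖δ‖ ≤ ‖η‖ := by
  obtain ⟨a, b, hab, hd⟩ := exists_root_pair p (δ ^ 2)
  have hn : ‖a‖ * ‖b‖ = ‖δ‖ ^ 2 := by rw [← norm_mul, hd, norm_pow]
  by_cases h : ‖δ‖ ≤ ‖a‖
  · exact ⟨a, by rw [← hab, ← hd]; ring, h⟩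
  · refine ⟨b, by rw [← hab, ← hd]; ring, ?_⟩
    push Not at h
    by_contra hb
    push Not at hb
    nlinarith [mul_lt_mul'' h hb (norm_nonneg a) (norm_nonneg b)]

open Filter Topology in
/-- At a local maximum of `|η^k g|` over the roots `η` of `η² - P η + δ²`, attained at a simple
root, the value `η^k g` is locally constant. -/
theorem exists_root_eq_of_isLocalMax_of_simple {P δ g : ℂ → ℂ} {z₀ η₀ : ℂ} (k : ℕ)
    (hP : AnalyticAt ℂ P z₀) (hδ : AnalyticAt ℂ δ z₀) (hg : AnalyticAt ℂ g z₀)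
    (hroot : η₀ ^ 2 - P z₀ * η₀ + δ z₀ ^ 2 = 0) (hs : 2 * η₀ ≠ P z₀)
    (hmax : ∀ᶠ z in 𝓝 z₀, ∀ η : ℂ, η ^ 2 - P z * η + δ z ^ 2 = 0 →
      ‖η ^ k * g z‖ ≤ ‖η₀ ^ k * g z₀‖) :
    ∀ᶠ z in 𝓝 z₀, ∃ η : ℂ, η ^ 2 - P z * η + δ z ^ 2 = 0 ∧ η ^ k * g z = η₀ ^ k * g z₀ := by
  obtain ⟨r, hr, hr0, hrr⟩ := exists_analyticAt_root hP hδ hroot hs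
  have hf : AnalyticAt ℂ (fun z => r z ^ k * g z) z₀ := by fun_prop
  have hloc : IsLocalMax (norm ∘ fun z => r z ^ k * g z) z₀ := by
    filter_upwards [hmax, hrr] with z h1 h2
    simpa [hr0] using h1 _ h2
  have := Complex.eventually_eq_of_isLocalMax_norm
    (hf.eventually_analyticAt.mono fun z hz => hz.differentiableAt) hloc
  filter_upwards [this, hrr] with z h1 h2
  exact ⟨r z, h2, by rw [h1, hr0]⟩

open Filter Topology in
/-- At a local maximum of `|η^k g|` over the roots `η` of `η² - P η + δ²`, the maximal
modulus is attained at all nearby points. -/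
theorem exists_root_norm_eq_of_isLocalMax {P δ g : ℂ → ℂ} {z₀ η₀ : ℂ} (k : ℕ)
    (hP : AnalyticAt ℂ P z₀) (hδ : AnalyticAt ℂ δ z₀) (hg : AnalyticAt ℂ g z₀)
    (hroot : η₀ ^ 2 - P z₀ * η₀ + δ z₀ ^ 2 = 0)
    (hmax : ∀ᶠ z in 𝓝 z₀, ∀ η : ℂ, η ^ 2 - P z * η + δ z ^ 2 = 0 →
      ‖η ^ k * g z‖ ≤ ‖η₀ ^ k * g z₀‖) :
    ∀ᶠ z in 𝓝 z₀, ∃ η : ℂ, η ^ 2 - P z * η + δ z ^ 2 = 0 ∧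
      ‖η ^ k * g z‖ = ‖η₀ ^ k * g z₀‖ := by
  -- At a double root no analytic branch need exist, but there |η₀| = |δ(z₀)|. Since the larger root
  -- always has modulus at least |δ|, the single-valued function δᵏg has a local maximum of modulus
  -- at z₀, so it is constant and squeezes the larger root.
  by_cases hs : 2 * η₀ = P z₀
  · have hsq : ‖η₀‖ = ‖δ z₀‖ := by
      have h1 : η₀ ^ 2 = δ z₀ ^ 2 := by rw [← hs] at hroot; linear_combination -hroot
      have h2 : ‖η₀‖ ^ 2 = ‖δ z₀‖ ^ 2 := by rw [← norm_pow, h1, norm_pow]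
      exact (pow_left_inj₀ (norm_nonneg _) (norm_nonneg _) two_ne_zero).1 h2
    have h0 : ‖η₀ ^ k * g z₀‖ = ‖δ z₀ ^ k * g z₀‖ := by simp [hsq]
    have key : ∀ᶠ z in 𝓝 z₀, ∃ η : ℂ, (η ^ 2 - P z * η + δ z ^ 2 = 0) ∧
        ‖δ z ^ k * g z‖ ≤ ‖η ^ k * g z‖ ∧ ‖η ^ k * g z‖ ≤ ‖η₀ ^ k * g z₀‖ := by
      filter_upwards [hmax] with z h1
      obtain ⟨η, h2, h3⟩ := exists_root_norm_ge (P z) (δ z)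
      refine ⟨η, h2, ?_, h1 η h2⟩
      rw [norm_mul, norm_mul, norm_pow, norm_pow]
      gcongr
    have hf : AnalyticAt ℂ (fun z => δ z ^ k * g z) z₀ := by fun_prop
    have hloc : IsLocalMax (norm ∘ fun z => δ z ^ k * g z) z₀ := by
      filter_upwards [key] with z ⟨η, _, h2, h3⟩
      exact (h2.trans h3).trans h0.le
    have := Complex.eventually_eq_of_isLocalMax_norm
      (hf.eventually_analyticAt.mono fun z hz => hz.differentiableAt) hloc
    filter_upwards [this, key] with z h1 ⟨η, h2, h3, h4⟩
    refine ⟨η, h2, le_antisymm h4 ?_⟩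
    rw [h0, ← h1]
    exact h3
  · filter_upwards [exists_root_eq_of_isLocalMax_of_simple k hP hδ hg hroot hs hmax]
      with z ⟨η, h1, h2⟩
    exact ⟨η, h1, by rw [h2]⟩

/-- A bound for the roots of `η² - p η + δ²`. -/
theorem norm_root_le {p δ η : ℂ} (h : η ^ 2 - p * η + δ ^ 2 = 0) : ‖η‖ ≤ ‖p‖ + ‖δ‖ := by
  by_contra hc
  push Not at hc
  have h1 : ‖η‖ ^ 2 ≤ ‖p‖ * ‖η‖ + ‖δ‖ ^ 2 := by
    rw [← norm_pow, ← norm_pow, ← norm_mul]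
    calc ‖η ^ 2‖ = ‖p * η - δ ^ 2‖ := by congr 1; linear_combination h
      _ ≤ _ := norm_sub_le _ _
  nlinarith [norm_nonneg p, norm_nonneg δ, norm_nonneg η]

open Filter Topology in
/-- Maximum principle for the roots of `η² - P η + δ²` off a compact set `E`, weighted by an
analytic function vanishing at infinity. -/
theorem norm_root_mul_le_of_isCompact {P δ g : ℂ → ℂ} {E : Set ℂ} (k : ℕ) {A : ℝ}
    (hE : IsCompact E) (hEne : E.Nonempty)
    (hP : Differentiable ℂ P) (hδ : Differentiable ℂ δ) (hg : DifferentiableOn ℂ g Eᶜ)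
    (hbd : ∀ z ∈ E, ∀ η : ℂ, η ^ 2 - P z * η + δ z ^ 2 = 0 → ‖η‖ ^ k ≤ A)
    (hg1 : ∀ z ∉ E, ‖g z‖ ≤ 1)
    (hinf : ∀ ε > 0, ∃ R : ℝ, ∀ z, R ≤ ‖z‖ → ∀ η : ℂ, η ^ 2 - P z * η + δ z ^ 2 = 0 →
      ‖η ^ k * g z‖ < ε)
    {z : ℂ} (hz : z ∉ E) {η : ℂ} (hη : η ^ 2 - P z * η + δ z ^ 2 = 0) :
    ‖η ^ k * g z‖ ≤ A := by
  by_contra hc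
  push Not at hc
  set c := ‖η ^ k * g z‖ with hcdef
  have hA : 0 ≤ A := by
    obtain ⟨w, hw⟩ := hEne
    obtain ⟨θ, h1, -⟩ := exists_root_norm_ge (P w) (δ w)
    exact (pow_nonneg (norm_nonneg _) k).trans (hbd w hw θ h1)
  have hc0 : 0 < c := hA.trans_lt hc
  have hgc : ContinuousOn g Eᶜ := hg.continuousOn
  have hEo : IsOpen Eᶜ := hE.isClosed.isOpen_compl
  set T₀ : Set (ℂ × ℂ) := {p | p.2 ^ 2 - P p.1 * p.2 + δ p.1 ^ 2 = 0 ∧ c ≤ ‖p.2‖ ^ k} with hT₀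
  have hPc := hP.continuous
  have hδc := hδ.continuous
  have hT₀c : IsClosed T₀ :=
    (isClosed_eq (by fun_prop) continuous_const).inter (isClosed_le continuous_const (continuous_snd.norm.pow k))
  -- Because |g| ≤ 1, a value at least c > A forces |η|ᵏ > A, which is excluded over E. Thus the
  -- closed set `T₀` stays off E, and no boundary behaviour of g is needed.
  have hT₀E : ∀ p ∈ T₀, p.1 ∈ Eᶜ := fun p hp hpE =>
    absurd ((hp.2).trans (hbd _ hpE _ hp.1)) (not_le.2 hc)
  have hfc : ContinuousOn (fun p : ℂ × ℂ => ‖p.2 ^ k * g p.1‖) T₀ := by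
    have : ContinuousOn (fun p : ℂ × ℂ => g p.1) T₀ := hgc.comp continuousOn_fst hT₀E
    exact ((continuousOn_snd.pow k).mul this).norm
  set T : Set (ℂ × ℂ) := T₀ ∩ (fun p : ℂ × ℂ => ‖p.2 ^ k * g p.1‖) ⁻¹' Set.Ici c with hT
  have hTmem : ∀ {w θ : ℂ}, w ∉ E → θ ^ 2 - P w * θ + δ w ^ 2 = 0 → c ≤ ‖θ ^ k * g w‖ →
      (w, θ) ∈ T := by
    intro w θ hw h1 h2
    refine ⟨⟨h1, h2.trans ?_⟩, h2⟩
    rw [norm_mul, norm_pow]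
    exact mul_le_of_le_one_right (by positivity) (hg1 w hw)
  have hTc : IsClosed T := hfc.preimage_isClosed_of_isClosed hT₀c isClosed_Ici
  have hTcomp : IsCompact T := by
    obtain ⟨R, hR⟩ := hinf c hc0
    obtain ⟨C, hC⟩ := (isCompact_closedBall (0 : ℂ) R).exists_bound_of_continuousOn
      (f := fun w => ‖P w‖ + ‖δ w‖) (by fun_prop)
    refine ((isCompact_closedBall (0 : ℂ) R).prod (isCompact_closedBall (0 : ℂ) C)).of_isClosed_subset
      hTc ?_
    rintro ⟨w, θ⟩ ⟨⟨h1, -⟩, h2⟩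
    have hw : ‖w‖ ≤ R := by
      by_contra h
      exact absurd h2 (not_le.2 (hR w (not_le.1 h).le θ h1))
    refine ⟨by simpa using hw, ?_⟩
    have h3 := hC w (by simpa using hw)
    simp only [mem_closedBall_zero_iff]
    exact (norm_root_le h1).trans ((le_abs_self _).trans h3)
  obtain ⟨⟨z₁, η₁⟩, hm, hmax⟩ := hTcomp.exists_isMaxOn ⟨_, hTmem hz hη hcdef.le⟩
    (hfc.mono Set.inter_subset_left)
  set S := ‖η₁ ^ k * g z₁‖ with hS
  have hcS : c ≤ S := hm.2
  have hglob : ∀ w ∉ E, ∀ θ : ℂ, θ ^ 2 - P w * θ + δ w ^ 2 = 0 → ‖θ ^ k * g w‖ ≤ S := by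
    intro w hw θ h1
    by_cases h : c ≤ ‖θ ^ k * g w‖
    · exact hmax (hTmem hw h1 h)
    · exact (not_le.1 h).le.trans hcS
  set T₁ : Set (ℂ × ℂ) := T ∩ (fun p : ℂ × ℂ => ‖p.2 ^ k * g p.1‖) ⁻¹' {S}
  have hT₁ : IsCompact T₁ := hTcomp.of_isClosed_subset
    ((hfc.mono Set.inter_subset_left).preimage_isClosed_of_isClosed hTc isClosed_singleton)
    Set.inter_subset_left
  set V : Set ℂ := Prod.fst '' T₁
  have hVc : IsClosed V := (hT₁.image continuous_fst).isClosed
  -- The projection of the set of maximum points is open by the local principle and closed by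
  -- compactness. It is nonempty, so it would be all of ℂ, although it misses E.
  have hVo : IsOpen V := by
    rw [isOpen_iff_mem_nhds]
    rintro _ ⟨⟨w, θ⟩, ⟨hwT, hwS⟩, rfl⟩
    have hwE : w ∉ E := hT₀E _ hwT.1
    have hnear : ∀ᶠ x in 𝓝 w, x ∈ Eᶜ := hEo.mem_nhds hwE
    have hwS' : ‖θ ^ k * g w‖ = S := hwS
    have := exists_root_norm_eq_of_isLocalMax (η₀ := θ) k (hP.analyticAt w) (hδ.analyticAt w)
      (hg.analyticAt (hEo.mem_nhds hwE)) hwT.1.1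
      (by
        filter_upwards [hnear] with x hx θ' h'
        rw [hwS']
        exact hglob x hx θ' h')
    filter_upwards [this, hnear] with x ⟨θ', h1, h2⟩ hx
    rw [hwS'] at h2
    exact ⟨(x, θ'), ⟨hTmem hx h1 (hcS.trans h2.ge), h2⟩, rfl⟩
  rcases isClopen_iff.1 ⟨hVc, hVo⟩ with h | h
  · have : z₁ ∈ V := ⟨(z₁, η₁), ⟨hm, rfl⟩, rfl⟩
    rw [h] at this
    exact this
  · obtain ⟨w, hw⟩ := hEne
    have : w ∈ V := h ▸ Set.mem_univ w
    obtain ⟨p, hp, rfl⟩ := this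
    exact hT₀E _ hp.1.1 hw

/-- Bernstein–Walsh type inequality for the roots of `η² - P η + (M zⁿ)²`. -/
theorem norm_root_mul_pow_le {P B : ℂ → ℂ} {E : Set ℂ} {n : ℕ} (hn : 1 ≤ n) {M : ℝ} (hM : 0 < M)
    (hE : IsCompact E) (hEne : E.Nonempty) (hP : Differentiable ℂ P)
    (hPb : ∃ C : ℝ, ∀ z, 1 ≤ ‖z‖ → ‖P z‖ ≤ C * ‖z‖ ^ (2 * n))
    (hB : DifferentiableOn ℂ B Eᶜ) (hB1 : ∀ z ∉ E, ‖B z‖ ≤ 1)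
    (hBinf : ∃ C R : ℝ, ∀ z, R ≤ ‖z‖ → ‖B z‖ * ‖z‖ ≤ C)
    (hbd : ∀ z ∈ E, ∀ η : ℂ, η ^ 2 - P z * η + (M * z ^ n) ^ 2 = 0 → ‖η‖ ≤ M)
    {z : ℂ} (hz : z ∉ E) {η : ℂ} (hη : η ^ 2 - P z * η + (M * z ^ n) ^ 2 = 0) :
    ‖η‖ * ‖B z‖ ^ (2 * n) ≤ M := by
  obtain ⟨C₁, hC₁⟩ := hPb
  obtain ⟨C₂, R, hC₂⟩ := hBinf
  -- The product ηB^{2n} is only bounded at infinity. Raising it to the power k and adding one more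
  -- factor B makes it vanish there; the extra factor disappears after k-th roots as k → ∞.
  have hk : ∀ k : ℕ, ‖η ^ k * B z ^ (2 * n * k + 1)‖ ≤ M ^ k := by
    intro k
    refine norm_root_mul_le_of_isCompact (P := P) (δ := fun z => M * z ^ n)
      (g := fun z => B z ^ (2 * n * k + 1)) k hE hEne hP (by fun_prop) (by fun_prop) ?_ ?_ ?_ hz hη
    · intro w hw θ hθ
      exact pow_le_pow_left₀ (norm_nonneg _) (hbd w hw θ hθ) k
    · intro w hw
      rw [norm_pow]
      exact pow_le_one₀ (norm_nonneg _) (hB1 w hw)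
    · intro ε hε
      set D : ℝ := (((|C₁| + M) * |C₂| ^ (2 * n)) ^ k * |C₂|) with hD
      have hD0 : 0 ≤ D := by positivity
      refine ⟨max (max 1 R) (D / ε + 1), fun w hw θ hθ => ?_⟩
      have hw1 : 1 ≤ ‖w‖ := ((le_max_left _ _).trans (le_max_left _ _)).trans hw
      have hwR : R ≤ ‖w‖ := ((le_max_right _ _).trans (le_max_left _ _)).trans hw
      have hwD : D / ε < ‖w‖ := (lt_add_one _).trans_le ((le_max_right _ _).trans hw)
      have hw0 : 0 < ‖w‖ := by linarith
      have h1 : ‖θ‖ ≤ (|C₁| + M) * ‖w‖ ^ (2 * n) := by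
        refine (norm_root_le hθ).trans ?_
        have h2 : ‖P w‖ ≤ |C₁| * ‖w‖ ^ (2 * n) :=
          (hC₁ w hw1).trans (by gcongr; exact le_abs_self _)
        have h3 : ‖(M : ℂ) * w ^ n‖ ≤ M * ‖w‖ ^ (2 * n) := by
          rw [norm_mul, norm_pow, Complex.norm_real, Real.norm_of_nonneg hM.le]
          have : ‖w‖ ^ n ≤ ‖w‖ ^ (2 * n) := pow_le_pow_right₀ hw1 (by omega)
          gcongr
        linarith
      have h4 : ‖B w‖ * ‖w‖ ≤ |C₂| := (hC₂ w hwR).trans (le_abs_self _)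
      have h5 : ‖θ ^ k * B w ^ (2 * n * k + 1)‖ * ‖w‖ ≤ D := by
        calc ‖θ ^ k * B w ^ (2 * n * k + 1)‖ * ‖w‖
            = (‖θ‖ * ‖B w‖ ^ (2 * n)) ^ k * (‖B w‖ * ‖w‖) := by
              rw [norm_mul, norm_pow, norm_pow, mul_pow, ← pow_mul, pow_succ]; ring
          _ ≤ ((|C₁| + M) * ‖w‖ ^ (2 * n) * ‖B w‖ ^ (2 * n)) ^ k * |C₂| := by gcongr
          _ = ((|C₁| + M) * (‖B w‖ * ‖w‖) ^ (2 * n)) ^ k * |C₂| := by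
              rw [mul_pow (‖B w‖)]; ring
          _ ≤ D := by rw [hD]; gcongr
      rw [div_lt_iff₀ hε] at hwD
      by_contra hcon
      push Not at hcon
      nlinarith
  by_contra hc
  push Not at hc
  have hb : 0 < ‖B z‖ := by
    rcases (norm_nonneg (B z)).eq_or_lt with h | h
    · rw [← h, zero_pow (by omega), mul_zero] at hc
      exact absurd hM (not_lt.2 hc.le)
    · exact h
  set x := ‖η‖ * ‖B z‖ ^ (2 * n) with hx
  obtain ⟨k, hk'⟩ := pow_unbounded_of_one_lt (1 / ‖B z‖) ((one_lt_div hM).2 hc)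
  have h1 := hk k
  have h2 : ‖η ^ k * B z ^ (2 * n * k + 1)‖ = x ^ k * ‖B z‖ := by
    rw [hx, norm_mul, norm_pow, norm_pow, mul_pow, ← pow_mul, pow_succ]; ring
  rw [h2] at h1
  rw [div_pow, div_lt_div_iff₀ hb (by positivity)] at hk'
  linarith

open Filter Topology in
/-- The equality case of `norm_root_mul_pow_le` at the origin. -/
theorem root_identity_of_eq {P B : ℂ → ℂ} {E G : Set ℂ} {n : ℕ} (hn : 1 ≤ n) {M : ℝ}
    (hM : 0 < M) (hE : IsCompact E) (hEne : E.Nonempty) (hP : Differentiable ℂ P)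
    (hPb : ∃ C : ℝ, ∀ z, 1 ≤ ‖z‖ → ‖P z‖ ≤ C * ‖z‖ ^ (2 * n))
    (hB : DifferentiableOn ℂ B Eᶜ) (hB1 : ∀ z ∉ E, ‖B z‖ ≤ 1)
    (hBinf : ∃ C R : ℝ, ∀ z, R ≤ ‖z‖ → ‖B z‖ * ‖z‖ ≤ C)
    (hbd : ∀ z ∈ E, ∀ η : ℂ, η ^ 2 - P z * η + (M * z ^ n) ^ 2 = 0 → ‖η‖ ≤ M)
    (hP0 : P 0 = 1) (hB0 : ‖B 0‖ ^ (2 * n) = M)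
    (hG : IsPreconnected G) (hG0 : 0 ∈ G) (hGE : G ⊆ Eᶜ) {z : ℂ} (hz : z ∈ G) :
    (B 0 ^ (2 * n)) ^ 2 - P z * B 0 ^ (2 * n) * B z ^ (2 * n)
      + (M * z ^ n) ^ 2 * (B z ^ (2 * n)) ^ 2 = 0 := by
  have hEo : IsOpen Eᶜ := hE.isClosed.isOpen_compl
  have han : AnalyticOnNhd ℂ (fun z => (B 0 ^ (2 * n)) ^ 2 - P z * B 0 ^ (2 * n) * B z ^ (2 * n)
      + (M * z ^ n) ^ 2 * (B z ^ (2 * n)) ^ 2) G := by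
    intro w hw
    have h1 := hB.analyticAt (hEo.mem_nhds (hGE hw))
    have h2 := hP.analyticAt w
    fun_prop
  have hn0 : n ≠ 0 := by omega
  refine han.eqOn_zero_of_preconnected_of_eventuallyEq_zero hG hG0 ?_ hz
  have hBan : AnalyticAt ℂ B 0 := hB.analyticAt (hEo.mem_nhds (hGE hG0))
  -- At the origin the quadratic is η² - η, whose root 1 is simple, so the value itself, not just
  -- its modulus, is locally constant.
  have := exists_root_eq_of_isLocalMax_of_simple (P := P) (δ := fun z => M * z ^ n)
    (g := fun z => B z ^ (2 * n)) (z₀ := 0) (η₀ := 1) 1 (hP.analyticAt 0) (by fun_prop)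
    (by fun_prop) (by simp [hP0, hn0]) (by rw [hP0]; norm_num)
    (by
      filter_upwards [hEo.mem_nhds (hGE hG0)] with w hw θ hθ
      have := norm_root_mul_pow_le hn hM hE hEne hP hPb hB hB1 hBinf hbd hw hθ
      simpa [hB0] using this)
  filter_upwards [this] with w ⟨θ, h1, h2⟩
  simp only [one_mul, pow_one] at h2
  rw [← h2, Pi.zero_apply]
  linear_combination (B w ^ (2 * n)) ^ 2 * h1

/-! ### The Herglotz integral of the indicator of Q. -/

/-- The point `e^{it}` of the unit circle. -/
def unitPoint (t : Torus) : ℂ := (AddCircle.toCircle t : ℂ)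

theorem unitPoint_coe (x : ℝ) : unitPoint (x : Torus) = Complex.exp (x * Complex.I) := by
  rw [unitPoint, AddCircle.toCircle_apply_mk, Circle.coe_exp, div_self Real.two_pi_pos.ne', one_mul]

theorem norm_unitPoint (t : Torus) : ‖unitPoint t‖ = 1 := Circle.norm_coe _

theorem unitPoint_ne_zero (t : Torus) : unitPoint t ≠ 0 := Circle.coe_ne_zero _

theorem continuous_unitPoint : Continuous unitPoint :=
  continuous_subtype_val.comp AddCircle.continuous_toCircle

theorem unitPoint_injective : Function.Injective unitPoint :=
  Circle.coe_injective.comp (AddCircle.injective_toCircle Real.two_pi_pos.ne')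

theorem unitPoint_pow (t : Torus) (k : ℕ) :
    unitPoint t ^ k = cosHarmonic k t + sinHarmonic k t * Complex.I := by
  induction t using QuotientAddGroup.induction_on with
  | H x =>
    rw [unitPoint_coe, cosHarmonic_coe, sinHarmonic_coe, ← Complex.exp_nat_mul, ← mul_assoc,
      Complex.exp_mul_I]
    push_cast
    rfl

theorem isCompact_image_unitPoint {Q : Set Torus} (hQ : IsCompact Q) :
    IsCompact (unitPoint '' Q) := hQ.image continuous_unitPoint

theorem unitPoint_sub_ne_zero {Q : Set Torus} {z : ℂ} (hz : z ∉ unitPoint '' Q) {t : Torus}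
    (ht : t ∈ Q) : unitPoint t - z ≠ 0 :=
  sub_ne_zero.2 fun h => hz ⟨t, ht, h⟩

/-- The Herglotz integral of the indicator function of `Q`. -/
def herglotz (Q : Set Torus) (z : ℂ) : ℂ :=
  ∫ t in Q, (unitPoint t + z) / (unitPoint t - z)

theorem integrableOn_herglotz {Q : Set Torus} (hQ : IsCompact Q) {z : ℂ}
    (hz : z ∉ unitPoint '' Q) :
    IntegrableOn (fun t => (unitPoint t + z) / (unitPoint t - z)) Q := by
  refine ContinuousOn.integrableOn_compact hQ ?_
  exact (continuous_unitPoint.add continuous_const).continuousOn.div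
    (continuous_unitPoint.sub continuous_const).continuousOn fun t ht => unitPoint_sub_ne_zero hz ht

theorem differentiableOn_herglotz {Q : Set Torus} (hQ : IsCompact Q) :
    DifferentiableOn ℂ (herglotz Q) (unitPoint '' Q)ᶜ := by
  intro z₀ hz₀
  apply DifferentiableAt.differentiableWithinAt
  have hE := (isCompact_image_unitPoint hQ).isClosed
  obtain ⟨ε, hε, hball⟩ := Metric.isOpen_iff.1 hE.isOpen_compl z₀ hz₀
  -- Halving the radius keeps the denominators at least ε/2, which dominates the derivative of the
  -- kernel under the integral.
  have hfar : ∀ z ∈ Metric.ball z₀ (ε / 2), ∀ t ∈ Q, ε / 2 ≤ ‖unitPoint t - z‖ := by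
    intro z hz t ht
    by_contra h
    push Not at h
    have : unitPoint t ∈ Metric.ball z₀ ε := by
      rw [Metric.mem_ball] at hz ⊢
      calc dist (unitPoint t) z₀ ≤ dist (unitPoint t) z + dist z z₀ := dist_triangle _ _ _
        _ < ε / 2 + ε / 2 := add_lt_add (by rwa [dist_eq_norm]) hz
        _ = ε := by ring
    exact hball this ⟨t, ht, rfl⟩
  have hnot : ∀ z ∈ Metric.ball z₀ (ε / 2), z ∉ unitPoint '' Q := by
    rintro z hz ⟨t, ht, rfl⟩
    have := hfar _ hz t ht
    simp at this
    linarith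
  have hmeas : MeasurableSet Q := hQ.isClosed.measurableSet
  have hz₀' : z₀ ∈ Metric.ball z₀ (ε / 2) := Metric.mem_ball_self (by positivity)
  refine (hasDerivAt_integral_of_dominated_loc_of_deriv_le
    (μ := volume.restrict Q) (F := fun z t => (unitPoint t + z) / (unitPoint t - z))
    (F' := fun z t => 2 * unitPoint t / (unitPoint t - z) ^ 2)
    (bound := fun _ => 2 / (ε / 2) ^ 2)
    (Metric.ball_mem_nhds z₀ (by positivity : 0 < ε / 2)) ?_ ?_ ?_ ?_ ?_ ?_).2.differentiableAt
  · filter_upwards [Metric.ball_mem_nhds z₀ (by positivity : 0 < ε / 2)] with z hz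
    exact (integrableOn_herglotz hQ (hnot z hz)).aestronglyMeasurable
  · exact integrableOn_herglotz hQ (hnot z₀ hz₀')
  · refine ContinuousOn.aestronglyMeasurable ?_ hmeas
    refine (continuous_const.mul continuous_unitPoint).continuousOn.div
      ((continuous_unitPoint.sub continuous_const).pow 2).continuousOn fun t ht => ?_
    exact pow_ne_zero 2 (unitPoint_sub_ne_zero (hnot z₀ hz₀') ht)
  · refine (ae_restrict_iff' hmeas).2 (Filter.Eventually.of_forall fun t ht z hz => ?_)
    rw [norm_div, norm_mul, norm_pow, norm_unitPoint, mul_one, Complex.norm_ofNat]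
    gcongr
    exact hfar z hz t ht
  · have : IsFiniteMeasure (volume.restrict Q) := ⟨by
      rw [Measure.restrict_apply_univ]; exact hQ.measure_lt_top⟩
    exact integrable_const _
  · refine (ae_restrict_iff' hmeas).2 (Filter.Eventually.of_forall fun t ht z hz => ?_)
    have h1 : HasDerivAt (fun z => unitPoint t + z) 1 z := (hasDerivAt_id z).const_add _
    have h2 : HasDerivAt (fun z => unitPoint t - z) (-1) z := (hasDerivAt_id z).const_sub _
    exact (h1.fun_div h2 (unitPoint_sub_ne_zero (hnot z hz) ht)).congr_deriv (by ring)

theorem volume_real_eq {Q : Set Torus} {α : ℝ} (hα : 0 ≤ α)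
    (hvol : volume Q = ENNReal.ofReal (2 * α)) : volume.real Q = 2 * α := by
  rw [Measure.real, hvol, ENNReal.toReal_ofReal (by linarith)]

theorem herglotz_zero {Q : Set Torus} {α : ℝ} (hα : 0 ≤ α)
    (hvol : volume Q = ENNReal.ofReal (2 * α)) : herglotz Q 0 = 2 * α := by
  have : ∀ t, (unitPoint t + 0) / (unitPoint t - 0) = 1 := fun t => by
    rw [add_zero, sub_zero, div_self (unitPoint_ne_zero t)]
  simp only [herglotz, this, setIntegral_const, volume_real_eq hα hvol]
  simp

/-- The kernel tends to -1 at infinity at rate 1/|z|; this rate gives the simple decay of `diskMap`.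
-/
theorem norm_herglotz_add_le {Q : Set Torus} (hQ : IsCompact Q) {α : ℝ} (hα : 0 ≤ α)
    (hvol : volume Q = ENNReal.ofReal (2 * α)) {z : ℂ} (hz : 2 ≤ ‖z‖) :
    ‖herglotz Q z + 2 * α‖ ≤ 8 * α / ‖z‖ := by
  have hzQ : z ∉ unitPoint '' Q := by
    rintro ⟨t, -, rfl⟩
    rw [norm_unitPoint] at hz
    linarith
  have hfin : volume Q < ⊤ := hQ.measure_lt_top
  have h1 : herglotz Q z + 2 * α =
      ∫ t in Q, ((unitPoint t + z) / (unitPoint t - z) + 1) := by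
    rw [integral_add (integrableOn_herglotz hQ hzQ) (integrableOn_const hfin.ne)]
    simp [herglotz, volume_real_eq hα hvol]
  rw [h1]
  refine (norm_setIntegral_le_of_norm_le_const (C := 4 / ‖z‖) hfin ?_).trans ?_
  · intro t ht
    have hne := unitPoint_sub_ne_zero hzQ ht
    have h2 : (unitPoint t + z) / (unitPoint t - z) + 1 = 2 * unitPoint t / (unitPoint t - z) := by
      field_simp; ring
    have h3 : ‖z‖ / 2 ≤ ‖unitPoint t - z‖ := by
      have := norm_sub_norm_le z (unitPoint t)
      rw [norm_unitPoint, norm_sub_rev] at this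
      linarith
    rw [h2, norm_div, norm_mul, norm_unitPoint, mul_one, Complex.norm_ofNat,
      div_le_div_iff₀ (by linarith) (by linarith)]
    linarith
  · rw [volume_real_eq hα hvol]
    apply le_of_eq
    ring

/-- This is the Poisson kernel: its sign depends only on the side of the unit circle, and it
vanishes on the circle. -/
theorem re_herglotz_kernel {u z : ℂ} (hu : ‖u‖ = 1) :
    ((u + z) / (u - z)).re = (1 - ‖z‖ ^ 2) / ‖u - z‖ ^ 2 := by
  have h1 : u.re * u.re + u.im * u.im = 1 := by
    rw [← Complex.normSq_apply, Complex.normSq_eq_norm_sq, hu]; norm_num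
  rw [Complex.div_re, ← Complex.normSq_eq_norm_sq, ← Complex.normSq_eq_norm_sq, ← add_div]
  congr 1
  simp only [Complex.add_re, Complex.sub_re, Complex.add_im, Complex.sub_im, Complex.normSq_apply]
  linear_combination h1

/-- The mean of the Herglotz kernel over the unit circle. -/
theorem integral_herglotz_kernel {z : ℂ} (hz : ‖z‖ ≠ 1) :
    ∫ t : Torus, (unitPoint t + z) / (unitPoint t - z) =
      if ‖z‖ < 1 then 2 * (Real.pi : ℂ) else - (2 * (Real.pi : ℂ)) := by
  rw [← AddCircle.intervalIntegral_preimage (2 * Real.pi) 0, zero_add]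
  have hci : (∮ w in C(0, 1), (w⁻¹ * ((w + z) / (w - z)))) =
      Complex.I * ∫ t in (0 : ℝ)..(2 * Real.pi),
        (unitPoint (t : Torus) + z) / (unitPoint (t : Torus) - z) := by
    rw [circleIntegral, ← intervalIntegral.integral_const_mul]
    refine intervalIntegral.integral_congr fun t _ => ?_
    simp only [unitPoint_coe, deriv_circleMap, circleMap, smul_eq_mul, zero_add, Complex.ofReal_one,
      one_mul]
    have := Complex.exp_ne_zero (t * Complex.I)
    field_simp
  -- Partial fractions: (w + z)/(w(w - z)) = 2/(w - z) - 1/w.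
  have hsplit : (∮ w in C(0, 1), (w⁻¹ * ((w + z) / (w - z)))) =
      2 * (∮ w in C(0, 1), (w - z)⁻¹) - ∮ w in C(0, 1), (w - 0)⁻¹ := by
    have hw : ∀ w ∈ Metric.sphere (0 : ℂ) 1, w ≠ 0 ∧ w - z ≠ 0 := by
      intro w hw
      rw [mem_sphere_zero_iff_norm] at hw
      refine ⟨fun h => by simp [h] at hw, fun h => hz ?_⟩
      rw [← sub_eq_zero.1 h, hw]
    have hi1 : CircleIntegrable (fun w => 2 * (w - z)⁻¹) 0 1 := by
      refine ContinuousOn.circleIntegrable zero_le_one ?_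
      exact continuousOn_const.mul
        ((continuousOn_id.sub continuousOn_const).inv₀ fun w h => (hw w h).2)
    have hi2 : CircleIntegrable (fun w : ℂ => (w - 0)⁻¹) 0 1 := by
      refine ContinuousOn.circleIntegrable zero_le_one ?_
      exact (continuousOn_id.sub continuousOn_const).inv₀ fun w h => by simpa using (hw w h).1
    rw [← circleIntegral.integral_const_mul, ← circleIntegral.integral_sub hi1 hi2]
    refine circleIntegral.integral_congr zero_le_one fun w h => ?_
    obtain ⟨h1, h2⟩ := hw w h
    simp only [sub_zero]
    field_simp
    ring
  have h0 : (∮ w in C(0, 1), (w - 0)⁻¹) = 2 * Real.pi * Complex.I :=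
    circleIntegral.integral_sub_inv_of_mem_ball (by simp)
  have hI := Complex.I_ne_zero
  split_ifs with h
  · have h1 : (∮ w in C(0, 1), (w - z)⁻¹) = 2 * Real.pi * Complex.I :=
      circleIntegral.integral_sub_inv_of_mem_ball (by simpa using h)
    rw [hsplit, h0, h1] at hci
    refine mul_left_cancel₀ hI (hci.symm.trans ?_)
    ring
  · have h1 : (∮ w in C(0, 1), (w - z)⁻¹) = 0 := by
      have hlt : 1 < ‖z‖ := lt_of_le_of_ne (not_lt.1 h) (Ne.symm hz)
      refine Complex.circleIntegral_eq_zero_of_differentiable_on_off_countable zero_le_one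
        Set.countable_empty ?_ ?_
      · refine (continuousOn_id.sub continuousOn_const).inv₀ fun w h => ?_
        rw [mem_closedBall_zero_iff] at h
        refine sub_ne_zero.2 fun h' => ?_
        simp only [id] at h'
        rw [h'] at h; linarith
      · intro w h
        have h := h.1
        rw [mem_ball_zero_iff] at h
        have : w - z ≠ 0 := sub_ne_zero.2 fun h' => by rw [h'] at h; linarith
        fun_prop (disch := assumption)
    rw [hsplit, h0, h1] at hci
    refine mul_left_cancel₀ hI (hci.symm.trans ?_)
    ring

theorem re_herglotz_eq {Q : Set Torus} (hQ : IsCompact Q) {z : ℂ} (hz : z ∉ unitPoint '' Q) :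
    (herglotz Q z).re = ∫ t in Q, (1 - ‖z‖ ^ 2) / ‖unitPoint t - z‖ ^ 2 := by
  have := (integral_re (integrableOn_herglotz hQ hz)).symm
  rw [herglotz]
  refine this.trans (integral_congr_ae (Filter.Eventually.of_forall fun t => ?_))
  exact re_herglotz_kernel (norm_unitPoint t)

theorem re_herglotz_of_norm_eq_one {Q : Set Torus} (hQ : IsCompact Q) {z : ℂ}
    (hz : z ∉ unitPoint '' Q) (h1 : ‖z‖ = 1) : (herglotz Q z).re = 0 := by
  simp [re_herglotz_eq hQ hz, h1]

/-- For fixed z the kernel has constant sign, so the integral over Q is dominated by the one over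
the whole circle, which is ±2π. -/
theorem abs_re_herglotz_le {Q : Set Torus} (hQ : IsCompact Q) {z : ℂ}
    (hz : z ∉ unitPoint '' Q) : |(herglotz Q z).re| ≤ 2 * Real.pi := by
  by_cases h1 : ‖z‖ = 1
  · rw [re_herglotz_of_norm_eq_one hQ hz h1, abs_zero]
    positivity
  have hzu : z ∉ unitPoint '' Set.univ := by
    rintro ⟨t, -, rfl⟩
    exact h1 (norm_unitPoint t)
  have hint := (integrableOn_herglotz isCompact_univ hzu).re
  have hk : ∀ t, RCLike.re ((unitPoint t + z) / (unitPoint t - z)) =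
      (1 - ‖z‖ ^ 2) / ‖unitPoint t - z‖ ^ 2 := fun t => re_herglotz_kernel (norm_unitPoint t)
  simp only [hk] at hint
  have htot := congrArg Complex.re (integral_herglotz_kernel h1)
  have htot' := re_herglotz_eq isCompact_univ hzu
  rw [herglotz, Measure.restrict_univ] at htot'
  rw [htot'] at htot
  rw [re_herglotz_eq hQ hz]
  rw [Measure.restrict_univ] at hint
  split_ifs at htot with hlt
  · have hpos : ∀ t, 0 ≤ (1 - ‖z‖ ^ 2) / ‖unitPoint t - z‖ ^ 2 := fun t =>
      div_nonneg (by nlinarith [norm_nonneg z]) (by positivity)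
    rw [abs_of_nonneg (integral_nonneg hpos)]
    refine (setIntegral_le_integral hint (Filter.Eventually.of_forall hpos)).trans (le_of_eq ?_)
    rw [htot]; simp
  · have hpos : ∀ t, 0 ≤ -((1 - ‖z‖ ^ 2) / ‖unitPoint t - z‖ ^ 2) := fun t => by
      rw [← neg_div]
      exact div_nonneg (by nlinarith [norm_nonneg z]) (by positivity)
    rw [← abs_neg, ← integral_neg, abs_of_nonneg (integral_nonneg hpos)]
    refine (setIntegral_le_integral hint.neg (Filter.Eventually.of_forall hpos)).trans (le_of_eq ?_)
    simp only [Pi.neg_apply]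
    rw [integral_neg, htot]; simp

/-! ### The bounded analytic function off Q. -/

/-- The exponential of the Herglotz integral, with values in the closed right half-plane. -/
def halfPlaneMap (Q : Set Torus) (z : ℂ) : ℂ := Complex.exp (Complex.I * herglotz Q z / 4)

/-- A bounded analytic function off `unitPoint '' Q`, vanishing at infinity. -/
def diskMap (Q : Set Torus) (α : ℝ) (z : ℂ) : ℂ :=
  (halfPlaneMap Q z - Complex.exp (-(α / 2 : ℝ) * Complex.I)) /
    (halfPlaneMap Q z + Complex.exp ((α / 2 : ℝ) * Complex.I))

theorem exp_ofReal_mul_I_re_im (x : ℝ) :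
    (Complex.exp (x * Complex.I)).re = Real.cos x ∧ (Complex.exp (x * Complex.I)).im = Real.sin x :=
  ⟨Complex.exp_ofReal_mul_I_re x, Complex.exp_ofReal_mul_I_im x⟩

theorem exp_neg_ofReal_mul_I_re_im (x : ℝ) :
    (Complex.exp (-(x : ℂ) * Complex.I)).re = Real.cos x ∧
      (Complex.exp (-(x : ℂ) * Complex.I)).im = -Real.sin x := by
  have := exp_ofReal_mul_I_re_im (-x)
  rwa [Complex.ofReal_neg, Real.cos_neg, Real.sin_neg] at this

theorem halfPlaneMap_re_nonneg {Q : Set Torus} (hQ : IsCompact Q) {z : ℂ}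
    (hz : z ∉ unitPoint '' Q) : 0 ≤ (halfPlaneMap Q z).re := by
  have h := abs_le.1 (abs_re_herglotz_le hQ hz)
  have him : (Complex.I * herglotz Q z / 4).im = (herglotz Q z).re / 4 := by
    rw [show (4 : ℂ) = ((4 : ℝ) : ℂ) by norm_num, Complex.div_ofReal_im]; simp
  rw [halfPlaneMap, Complex.exp_re, him]
  exact mul_nonneg (Real.exp_pos _).le
    (Real.cos_nonneg_of_mem_Icc ⟨by linarith [h.1], by linarith [h.2]⟩)

theorem halfPlaneMap_of_norm_eq_one {Q : Set Torus} (hQ : IsCompact Q) {z : ℂ}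
    (hz : z ∉ unitPoint '' Q) (h1 : ‖z‖ = 1) : ∃ r : ℝ, 0 < r ∧ halfPlaneMap Q z = r := by
  refine ⟨Real.exp (-(herglotz Q z).im / 4), Real.exp_pos _, ?_⟩
  have h0 := re_herglotz_of_norm_eq_one hQ hz h1
  rw [halfPlaneMap, Complex.ofReal_exp]
  congr 1
  conv_lhs => rw [← Complex.re_add_im (herglotz Q z), h0]
  push_cast
  linear_combination (herglotz Q z).im / 4 * Complex.I_sq

theorem cos_half_pos {α : ℝ} (hα0 : 0 < α) (hαπ : α < Real.pi) : 0 < Real.cos (α / 2) :=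
  Real.cos_pos_of_mem_Ioo ⟨by linarith, by linarith⟩

theorem sin_half_pos {α : ℝ} (hα0 : 0 < α) (hαπ : α < Real.pi) : 0 < Real.sin (α / 2) :=
  Real.sin_pos_of_pos_of_lt_pi (by linarith) (by linarith)

theorem cos_half_le_norm_add {α : ℝ} (w : ℂ) (hw : 0 ≤ w.re) :
    Real.cos (α / 2) ≤ ‖w + Complex.exp ((α / 2 : ℝ) * Complex.I)‖ := by
  refine le_trans ?_ (Complex.re_le_norm _)
  rw [Complex.add_re, (exp_ofReal_mul_I_re_im _).1]
  linarith

/-- The two points subtracted from w, e^{-iα/2} and -e^{iα/2}, are mirror images in the imaginary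
axis. The identity gives |B| ≤ 1 and, for real w, the exact size of 1 - |B|². -/
theorem normSq_add_sub_normSq_sub (α : ℝ) (w : ℂ) :
    ‖w + Complex.exp ((α / 2 : ℝ) * Complex.I)‖ ^ 2 -
      ‖w - Complex.exp (-(α / 2 : ℝ) * Complex.I)‖ ^ 2 = 4 * Real.cos (α / 2) * w.re := by
  rw [← Complex.normSq_eq_norm_sq, ← Complex.normSq_eq_norm_sq, Complex.normSq_apply,
    Complex.normSq_apply]
  simp only [Complex.add_re, Complex.add_im, Complex.sub_re, Complex.sub_im,
    exp_ofReal_mul_I_re_im, exp_neg_ofReal_mul_I_re_im]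
  ring

theorem norm_diskMap_le {Q : Set Torus} (hQ : IsCompact Q) {α : ℝ} (hα0 : 0 < α)
    (hαπ : α < Real.pi) {z : ℂ} (hz : z ∉ unitPoint '' Q) : ‖diskMap Q α z‖ ≤ 1 := by
  have hw := halfPlaneMap_re_nonneg hQ hz
  have hc := cos_half_pos hα0 hαπ
  have h1 := cos_half_le_norm_add (α := α) _ hw
  rw [diskMap, norm_div, div_le_one (by linarith)]
  have h2 := normSq_add_sub_normSq_sub α (halfPlaneMap Q z)
  refine (pow_le_pow_iff_left₀ (norm_nonneg _) (norm_nonneg _) two_ne_zero).1 ?_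
  nlinarith [mul_nonneg hc.le hw]

theorem differentiableOn_diskMap {Q : Set Torus} (hQ : IsCompact Q) {α : ℝ} (hα0 : 0 < α)
    (hαπ : α < Real.pi) : DifferentiableOn ℂ (diskMap Q α) (unitPoint '' Q)ᶜ := by
  have h : DifferentiableOn ℂ (halfPlaneMap Q) (unitPoint '' Q)ᶜ :=
    (((differentiableOn_herglotz hQ).const_mul Complex.I).div_const 4).cexp
  refine (h.sub_const _).div (h.add_const _) fun z hz h0 => ?_
  have h1 := cos_half_le_norm_add (α := α) _ (halfPlaneMap_re_nonneg hQ hz)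
  rw [h0, norm_zero] at h1
  linarith [cos_half_pos hα0 hαπ]

theorem diskMap_zero {Q : Set Torus} {α : ℝ} (hα0 : 0 < α)
    (hvol : volume Q = ENNReal.ofReal (2 * α)) :
    diskMap Q α 0 =
      Complex.I * Real.sin (α / 2) * Complex.exp (-(α / 2 : ℝ) * Complex.I) := by
  have h1 : halfPlaneMap Q 0 = Complex.exp ((α / 2 : ℝ) * Complex.I) := by
    rw [halfPlaneMap, herglotz_zero hα0.le hvol]
    congr 1
    push_cast
    ring
  have hne := Complex.exp_ne_zero ((α / 2 : ℝ) * Complex.I)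
  rw [diskMap, h1, Complex.ofReal_sin, Complex.sin, neg_mul, Complex.exp_neg]
  field_simp
  linear_combination 2 * (Complex.exp ((α / 2 : ℝ) * Complex.I) ^ 2 - 1) * Complex.I_sq

theorem norm_diskMap_zero {Q : Set Torus} {α : ℝ} (hα0 : 0 < α) (hαπ : α < Real.pi)
    (hvol : volume Q = ENNReal.ofReal (2 * α)) : ‖diskMap Q α 0‖ = Real.sin (α / 2) := by
  rw [diskMap_zero hα0 hvol, ← Complex.ofReal_neg, norm_mul, norm_mul, Complex.norm_I,
    Complex.norm_exp_ofReal_mul_I, Complex.norm_real,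
    Real.norm_of_nonneg (sin_half_pos hα0 hαπ).le]
  ring

theorem norm_diskMap_mul_le {Q : Set Torus} (hQ : IsCompact Q) {α : ℝ} (hα0 : 0 < α)
    (hαπ : α < Real.pi) (hvol : volume Q = ENNReal.ofReal (2 * α)) :
    ∃ C R : ℝ, ∀ z, R ≤ ‖z‖ → ‖diskMap Q α z‖ * ‖z‖ ≤ C := by
  refine ⟨4 * α / Real.cos (α / 2), max 2 (2 * α), fun z hz => ?_⟩
  have hz2 : 2 ≤ ‖z‖ := (le_max_left _ _).trans hz
  have hzα : 2 * α ≤ ‖z‖ := (le_max_right _ _).trans hz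
  have hz0 : 0 < ‖z‖ := by linarith
  have hzQ : z ∉ unitPoint '' Q := by
    rintro ⟨t, -, rfl⟩
    rw [norm_unitPoint] at hz2
    linarith
  have hc := cos_half_pos hα0 hαπ
  have h1 := cos_half_le_norm_add (α := α) _ (halfPlaneMap_re_nonneg hQ hzQ)
  have h2 := norm_herglotz_add_le hQ hα0.le hvol hz2
  set x : ℂ := Complex.I * (herglotz Q z + 2 * α) / 4 with hx
  have hxn : ‖x‖ ≤ 2 * α / ‖z‖ := by
    rw [hx, norm_div, norm_mul, Complex.norm_I, one_mul, Complex.norm_ofNat, div_le_iff₀ (by norm_num)]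
    refine h2.trans (le_of_eq (by ring))
  have h3 : halfPlaneMap Q z - Complex.exp (-(α / 2 : ℝ) * Complex.I) =
      Complex.exp (-(α / 2 : ℝ) * Complex.I) * (Complex.exp x - 1) := by
    rw [mul_sub, ← Complex.exp_add, mul_one, halfPlaneMap]
    congr 2
    rw [hx]
    push_cast
    ring
  have h4 : ‖halfPlaneMap Q z - Complex.exp (-(α / 2 : ℝ) * Complex.I)‖ ≤ 4 * α / ‖z‖ := by
    rw [h3, norm_mul, ← Complex.ofReal_neg, Complex.norm_exp_ofReal_mul_I, one_mul]
    have h5 := Complex.norm_exp_sub_one_le (x := x)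
      (hxn.trans ((div_le_one hz0).2 hzα))
    refine h5.trans ((mul_le_mul_of_nonneg_left hxn zero_le_two).trans (le_of_eq (by ring)))
  rw [diskMap, norm_div]
  calc _ ≤ 4 * α / ‖z‖ / Real.cos (α / 2) * ‖z‖ := by gcongr
    _ = _ := by field_simp

/-! ### The lower bound. -/

/-- The polynomial `2 zⁿ F(z)` attached to `F = cos nt - f`, where `f` is a trigonometric
polynomial of order less than `n`. -/
theorem exists_polynomial_of_mem_trigPoly {n : ℕ} (hn : 1 ≤ n) {f : Torus → ℝ}
    (hf : f ∈ trigPoly (n - 1)) :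
    ∃ P : ℂ → ℂ, Differentiable ℂ P ∧ (∃ C : ℝ, ∀ z, 1 ≤ ‖z‖ → ‖P z‖ ≤ C * ‖z‖ ^ (2 * n)) ∧
      P 0 = 1 ∧ ∀ t, P (unitPoint t) = 2 * (cosHarmonic n t - f t : ℝ) * unitPoint t ^ n := by
  obtain ⟨a, b, hf⟩ := hf
  have hmon : ∀ (c : ℂ) (j : ℕ), j ≤ 2 * n →
      ∃ C : ℝ, ∀ z : ℂ, 1 ≤ ‖z‖ → ‖c * z ^ j‖ ≤ C * ‖z‖ ^ (2 * n) := by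
    refine fun c j hj => ⟨‖c‖, fun z hz => ?_⟩
    rw [norm_mul, norm_pow]
    exact mul_le_mul_of_nonneg_left (pow_le_pow_right₀ hz hj) (norm_nonneg _)
  have hadd : ∀ p q : ℂ → ℂ, (∃ C : ℝ, ∀ z, 1 ≤ ‖z‖ → ‖p z‖ ≤ C * ‖z‖ ^ (2 * n)) →
      (∃ C : ℝ, ∀ z, 1 ≤ ‖z‖ → ‖q z‖ ≤ C * ‖z‖ ^ (2 * n)) →
      ∃ C : ℝ, ∀ z, 1 ≤ ‖z‖ → ‖p z + q z‖ ≤ C * ‖z‖ ^ (2 * n) := by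
    rintro p q ⟨C, hC⟩ ⟨D, hD⟩
    refine ⟨C + D, fun z hz => (norm_add_le _ _).trans ?_⟩
    rw [add_mul]
    exact add_le_add (hC z hz) (hD z hz)
  have hsum : ∀ (s : Finset ℕ) (p : ℕ → ℂ → ℂ),
      (∀ k ∈ s, ∃ C : ℝ, ∀ z, 1 ≤ ‖z‖ → ‖p k z‖ ≤ C * ‖z‖ ^ (2 * n)) →
      ∃ C : ℝ, ∀ z, 1 ≤ ‖z‖ → ‖∑ k ∈ s, p k z‖ ≤ C * ‖z‖ ^ (2 * n) := by
    intro s p hp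
    choose! C hC using hp
    refine ⟨∑ k ∈ s, C k, fun z hz => (norm_sum_le _ _).trans ?_⟩
    rw [Finset.sum_mul]
    exact Finset.sum_le_sum fun k hk => hC k hk z hz
  -- The constant term 1 comes from 2zⁿ cos nt = z^{2n} + 1. The remaining exponents n and n ± k
  -- with 1 ≤ k < n are positive, so nothing else survives at 0.
  refine ⟨fun z => 1 * z ^ (2 * n) + (1 * z ^ 0 + (-(a 0 : ℂ) * z ^ n +
    ∑ k ∈ Finset.Icc 1 (n - 1), ((-(a k : ℂ) + b k * Complex.I) * z ^ (n + k) +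
      (-(a k : ℂ) - b k * Complex.I) * z ^ (n - k)))), by fun_prop, ?_, ?_, fun t => ?_⟩
  · refine hadd _ _ (hmon _ _ le_rfl) (hadd _ _ (hmon _ _ (by omega))
      (hadd _ _ (hmon _ _ (by omega)) (hsum _ _ fun k hk => hadd _ _ (hmon _ _ ?_) (hmon _ _ ?_))))
    all_goals rw [Finset.mem_Icc] at hk; omega
  · have : ∑ k ∈ Finset.Icc 1 (n - 1), ((-(a k : ℂ) + b k * Complex.I) * (0 : ℂ) ^ (n + k) +
      (-(a k : ℂ) - b k * Complex.I) * (0 : ℂ) ^ (n - k)) = 0 := by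
      refine Finset.sum_eq_zero fun k hk => ?_
      rw [Finset.mem_Icc] at hk
      rw [zero_pow (by omega), zero_pow (by omega)]
      ring
    simp only [this, pow_zero]
    rw [zero_pow (by omega), zero_pow (by omega)]
    simp
  · set w := unitPoint t
    have hconj : ∀ k : ℕ, w ^ k * ((cosHarmonic k t : ℂ) - sinHarmonic k t * Complex.I) = 1 := by
      intro k
      have h1 : ‖w ^ k‖ = 1 := by rw [norm_pow, norm_unitPoint, one_pow]
      have h2 := unitPoint_pow t k
      change w ^ k = _ at h2
      have h3 : (starRingEnd ℂ) (w ^ k) = (cosHarmonic k t : ℂ) - sinHarmonic k t * Complex.I := by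
        rw [h2]
        simp [sub_eq_add_neg]
      rw [← h3, Complex.mul_conj, Complex.normSq_eq_norm_sq, h1]
      norm_num
    have hsub : ∀ k ≤ n, w ^ (n - k) =
        w ^ n * ((cosHarmonic k t : ℂ) - sinHarmonic k t * Complex.I) := by
      intro k hk
      calc w ^ (n - k) = w ^ (n - k) * (w ^ k * ((cosHarmonic k t : ℂ) -
            sinHarmonic k t * Complex.I)) := by rw [hconj, mul_one]
        _ = _ := by rw [← mul_assoc, ← pow_add, Nat.sub_add_cancel hk]
    have h2n : w ^ (2 * n) = w ^ n * ((cosHarmonic n t : ℂ) + sinHarmonic n t * Complex.I) := by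
      rw [← unitPoint_pow, ← pow_add, two_mul]
    have h1n : (1 : ℂ) = w ^ n * ((cosHarmonic n t : ℂ) - sinHarmonic n t * Complex.I) :=
      (hconj n).symm
    have hS : ∑ k ∈ Finset.Icc 1 (n - 1), ((-(a k : ℂ) + b k * Complex.I) * w ^ (n + k) +
        (-(a k : ℂ) - b k * Complex.I) * w ^ (n - k)) =
        -(2 * w ^ n) * ∑ k ∈ Finset.Icc 1 (n - 1),
          ((a k : ℂ) * cosHarmonic k t + b k * sinHarmonic k t) := by
      rw [Finset.mul_sum]
      refine Finset.sum_congr rfl fun k hk => ?_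
      rw [Finset.mem_Icc] at hk
      rw [hsub k (by omega), pow_add, unitPoint_pow t k]
      linear_combination (2 * w ^ n * b k * sinHarmonic k t) * Complex.I_sq
    beta_reduce
    rw [hS, hf t, h2n, pow_zero]
    push_cast
    linear_combination h1n

/-- Roots of a real quadratic with positive constant term. -/
theorem im_eq_zero_or_norm_eq {X : ℂ} {F M : ℝ} (hM : 0 ≤ M)
    (h : X ^ 2 - 2 * F * X + M ^ 2 = 0) : X.im = 0 ∨ ‖X‖ = M := by
  have hre := congrArg Complex.re h
  have him := congrArg Complex.im h
  simp [pow_two] at hre him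
  by_cases hy : X.im = 0
  · exact Or.inl hy
  · right
    have hx : X.re = F := mul_right_cancel₀ hy (by linear_combination him / 2)
    have h2 : ‖X‖ ^ 2 = M ^ 2 := by
      rw [← Complex.normSq_eq_norm_sq, Complex.normSq_apply]
      rw [hx] at hre ⊢
      linarith
    exact (pow_left_inj₀ (norm_nonneg _) hM two_ne_zero).1 h2

/-- For |F| ≤ M the discriminant F² - M² is nonpositive, so the roots are conjugate or equal, with
product M². -/
theorem norm_eq_of_abs_le {X : ℂ} {F M : ℝ} (hM : 0 ≤ M) (hF : |F| ≤ M)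
    (h : X ^ 2 - 2 * F * X + M ^ 2 = 0) : ‖X‖ = M := by
  rcases im_eq_zero_or_norm_eq hM h with h0 | h0
  · have hre := congrArg Complex.re h
    simp [pow_two, h0] at hre
    have hFM : F ^ 2 ≤ M ^ 2 := sq_le_sq' (abs_le.1 hF).1 (abs_le.1 hF).2
    have h1 : X.re = F := by nlinarith [sq_nonneg (X.re - F)]
    have h2 : ‖X‖ ^ 2 = M ^ 2 := by
      rw [← Complex.normSq_eq_norm_sq, Complex.normSq_apply, h0]
      rw [h1] at hre ⊢
      linarith
    exact (pow_left_inj₀ (norm_nonneg _) hM two_ne_zero).1 h2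
  · exact h0

theorem norm_root_le_of_abs_le {n : ℕ} {Q : Set Torus} {P : ℂ → ℂ} {F : Torus → ℝ} {M : ℝ}
    (hM : 0 ≤ M) (hP : ∀ t, P (unitPoint t) = 2 * (F t : ℝ) * unitPoint t ^ n)
    (hF : ∀ t ∈ Q, |F t| ≤ M) :
    ∀ z ∈ unitPoint '' Q, ∀ η : ℂ, η ^ 2 - P z * η + (M * z ^ n) ^ 2 = 0 → ‖η‖ ≤ M := by
  rintro _ ⟨t, ht, rfl⟩ η hη
  have hne : unitPoint t ^ n ≠ 0 := pow_ne_zero n (unitPoint_ne_zero t)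
  have h1 : (η / unitPoint t ^ n) ^ 2 - 2 * (F t : ℝ) * (η / unitPoint t ^ n) + (M : ℂ) ^ 2 = 0 := by
    rw [hP t] at hη
    field_simp
    linear_combination hη
  have h2 := norm_eq_of_abs_le hM (hF t ht) h1
  rw [norm_div, norm_pow, norm_unitPoint, one_pow, div_one] at h2
  exact h2.le

theorem nonempty_of_volume {Q : Set Torus} {α : ℝ} (hα0 : 0 < α)
    (hvol : volume Q = ENNReal.ofReal (2 * α)) : Q.Nonempty := by
  refine nonempty_of_measure_ne_zero (μ := volume) ?_
  rw [hvol, ne_eq, ENNReal.ofReal_eq_zero, not_le]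
  linarith

theorem zero_notMem_image_unitPoint (Q : Set Torus) : (0 : ℂ) ∉ unitPoint '' Q := by
  rintro ⟨t, -, h⟩
  exact unitPoint_ne_zero t h

theorem sin_pow_le_of_abs_le {n : ℕ} (hn : 1 ≤ n) {α : ℝ} (hα0 : 0 < α) (hαπ : α < Real.pi)
    {Q : Set Torus} (hQ : IsCompact Q) (hvol : volume Q = ENNReal.ofReal (2 * α))
    {f : Torus → ℝ} (hf : f ∈ trigPoly (n - 1)) {M : ℝ} (hM : 0 < M)
    (hF : ∀ t ∈ Q, |cosHarmonic n t - f t| ≤ M) : Real.sin (α / 2) ^ (2 * n) ≤ M := by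
  obtain ⟨P, hPd, hPb, hP0, hPu⟩ := exists_polynomial_of_mem_trigPoly hn hf
  have := norm_root_mul_pow_le hn hM (isCompact_image_unitPoint hQ)
    ((nonempty_of_volume hα0 hvol).image _) hPd hPb (differentiableOn_diskMap hQ hα0 hαπ)
    (fun z hz => norm_diskMap_le hQ hα0 hαπ hz) (norm_diskMap_mul_le hQ hα0 hαπ hvol)
    (norm_root_le_of_abs_le hM.le hPu hF) (zero_notMem_image_unitPoint Q) (η := 1)
    (by rw [hP0, zero_pow (by omega)]; ring)
  rwa [norm_one, one_mul, norm_diskMap_zero hα0 hαπ hvol] at this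

/-! ### Equality: the phase of B on the gaps of Q. -/

/-- The square of the phase of the disk map, in terms of the half-plane map. -/
def phaseRatio (α : ℝ) (w : ℂ) : ℂ :=
  (w ^ 2 - Complex.exp (-(α : ℂ) * Complex.I)) / (w ^ 2 - Complex.exp (α * Complex.I))

theorem sq_sub_exp_ne_zero {α : ℝ} (hα0 : 0 < α) (hαπ : α < Real.pi) (r : ℝ) :
    (r : ℂ) ^ 2 - Complex.exp (α * Complex.I) ≠ 0 := by
  intro h
  have := congrArg Complex.im h
  rw [Complex.sub_im, (exp_ofReal_mul_I_re_im α).2, ← Complex.ofReal_pow, Complex.ofReal_im] at this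
  simp at this
  linarith [Real.sin_pos_of_pos_of_lt_pi hα0 hαπ]

/-- On the circle off Q the half-plane value is a positive real r, and then B divided by its
conjugate depends only on r². -/
theorem half_angle_identities {α : ℝ} {w B : ℂ} {r : ℝ} (hα0 : 0 < α) (hαπ : α < Real.pi)
    (hr : 0 < r) (hw : w = r)
    (hB : B = (w - Complex.exp (-(α / 2 : ℝ) * Complex.I)) /
      (w + Complex.exp ((α / 2 : ℝ) * Complex.I))) :
    B ^ 2 = (‖B‖ ^ 2 : ℝ) * phaseRatio α w ∧
      1 - ‖B‖ ^ 2 = 4 * r * Real.cos (α / 2) / (r ^ 2 + 2 * r * Real.cos (α / 2) + 1) := by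
  subst hw
  have hs := sin_half_pos hα0 hαπ
  have hc := cos_half_pos hα0 hαπ
  set p := Complex.exp ((α / 2 : ℝ) * Complex.I) with hp
  set m := Complex.exp (-(α / 2 : ℝ) * Complex.I) with hm
  have hpm : starRingEnd ℂ p = m := by
    rw [hp, hm, ← Complex.exp_conj, map_mul, Complex.conj_ofReal, Complex.conj_I]; congr 1; ring
  have hmp : starRingEnd ℂ m = p := by rw [← hpm, Complex.conj_conj]
  have hp2 : Complex.exp (α * Complex.I) = p ^ 2 := by
    rw [hp, ← Complex.exp_nat_mul]; congr 1; push_cast; ring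
  have hm2 : Complex.exp (-(α : ℂ) * Complex.I) = m ^ 2 := by
    rw [hm, ← Complex.exp_nat_mul]; congr 1; push_cast; ring
  have hpre := exp_ofReal_mul_I_re_im (α / 2)
  have hmre := exp_neg_ofReal_mul_I_re_im (α / 2)
  rw [← hp] at hpre
  rw [← hm] at hmre
  have h1 : (r : ℂ) - p ≠ 0 := fun h => by
    have := congrArg Complex.im h
    simp [hpre.2] at this
    linarith
  have h2 : (r : ℂ) + p ≠ 0 := fun h => by
    have := congrArg Complex.im h
    simp [hpre.2] at this
    linarith
  have h3 : (r : ℂ) + m ≠ 0 := fun h => by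
    have := congrArg Complex.im h
    simp [hmre.2] at this
    linarith
  constructor
  · have hn : ((‖B‖ ^ 2 : ℝ) : ℂ) = B * ((r - p) / (r + m)) := by
      have : (r - p) / (r + m) = starRingEnd ℂ B := by
        rw [hB]; simp [hpm, hmp]
      rw [this, Complex.mul_conj, Complex.normSq_eq_norm_sq]
    have h4 : (r : ℂ) ^ 2 - p ^ 2 ≠ 0 := by
      rw [sq_sub_sq]; exact mul_ne_zero h2 h1
    rw [hn, phaseRatio, hp2, hm2, hB]
    field_simp
    ring
  · have h5 := normSq_add_sub_normSq_sub α (r : ℂ)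
    have h6 : ‖(r : ℂ) + p‖ ^ 2 = r ^ 2 + 2 * r * Real.cos (α / 2) + 1 := by
      rw [← Complex.normSq_eq_norm_sq, Complex.normSq_apply, Complex.add_re, Complex.add_im,
        hpre.1, hpre.2, Complex.ofReal_re, Complex.ofReal_im]
      linear_combination Real.sin_sq_add_cos_sq (α / 2)
    have h7 : 0 < r ^ 2 + 2 * r * Real.cos (α / 2) + 1 := by positivity
    rw [hB, norm_div, div_pow, ← h6, eq_div_iff (by rw [h6]; exact h7.ne'), sub_mul,
      div_mul_cancel₀ _ (by rw [h6]; exact h7.ne'), one_mul, h5, Complex.ofReal_re]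
    ring

/-- The phase ratio tends to e^{-2iα} as r → 0 and to 1 as r → ∞, the two ways in which |B| → 1. The
product of distances covers both without deciding between them. -/
theorem norm_phaseRatio_mul_le {α r : ℝ} (hα0 : 0 < α) (hαπ : α < Real.pi) (hr : 0 < r) :
    ‖phaseRatio α r - 1‖ * ‖phaseRatio α r - Complex.exp (-(2 * α : ℝ) * Complex.I)‖ ≤
      4 * (4 * r * Real.cos (α / 2) / (r ^ 2 + 2 * r * Real.cos (α / 2) + 1)) := by
  have hs := sin_half_pos hα0 hαπ
  have hc := cos_half_pos hα0 hαπ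
  have hc1 := Real.cos_le_one (α / 2)
  have hsc := Real.sin_sq_add_cos_sq (α / 2)
  have hne := sq_sub_exp_ne_zero hα0 hαπ r
  have hsin : Real.sin α = 2 * Real.sin (α / 2) * Real.cos (α / 2) := by
    rw [← Real.sin_two_mul]; congr 1; ring
  have hcos : Real.cos α = 2 * Real.cos (α / 2) ^ 2 - 1 := by
    rw [← Real.cos_two_mul]; congr 1; ring
  set p := Complex.exp (α * Complex.I) with hp
  set m := Complex.exp (-(α : ℂ) * Complex.I) with hm
  have hpm : p * m = 1 := by rw [hp, hm, ← Complex.exp_add]; simp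
  have hm2 : Complex.exp (-(2 * α : ℝ) * Complex.I) = m ^ 2 := by
    rw [hm, ← Complex.exp_nat_mul]; congr 1; push_cast; ring
  have hmn : ‖m‖ = 1 := by rw [hm, ← Complex.ofReal_neg, Complex.norm_exp_ofReal_mul_I]
  have hd : ‖p - m‖ = 2 * Real.sin α := by
    have : p - m = ((2 * Real.sin α : ℝ) : ℂ) * Complex.I := by
      rw [hp, hm, Complex.ofReal_mul, Complex.ofReal_sin, Complex.sin]
      push_cast
      linear_combination (Complex.exp (α * Complex.I) -
        Complex.exp (-(α : ℂ) * Complex.I)) * Complex.I_sq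
    rw [this, norm_mul, Complex.norm_I, mul_one, Complex.norm_real, Real.norm_of_nonneg]
    rw [hsin]; positivity
  have h1 : ‖phaseRatio α r - 1‖ = 2 * Real.sin α / ‖(r : ℂ) ^ 2 - p‖ := by
    rw [← hd, ← norm_div]
    congr 1
    rw [phaseRatio, ← hp, ← hm]
    field_simp
    ring
  have h2 : ‖phaseRatio α r - Complex.exp (-(2 * α : ℝ) * Complex.I)‖ =
      r ^ 2 * (2 * Real.sin α) / ‖(r : ℂ) ^ 2 - p‖ := by
    have : phaseRatio α r - Complex.exp (-(2 * α : ℝ) * Complex.I) =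
        r ^ 2 * (m * (p - m)) / ((r : ℂ) ^ 2 - p) := by
      rw [phaseRatio, ← hp, ← hm, hm2]
      field_simp
      linear_combination (m - (r : ℂ) ^ 2) * hpm
    rw [this, norm_div, norm_mul, norm_mul, hmn, hd, norm_pow, Complex.norm_real,
      Real.norm_of_nonneg hr.le, one_mul]
  have hN : ‖(r : ℂ) ^ 2 - p‖ ^ 2 = (r ^ 2 + 1) ^ 2 - 4 * Real.cos (α / 2) ^ 2 * r ^ 2 := by
    rw [← Complex.normSq_eq_norm_sq, Complex.normSq_apply, Complex.sub_re, Complex.sub_im,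
      (exp_ofReal_mul_I_re_im α).1, (exp_ofReal_mul_I_re_im α).2, ← Complex.ofReal_pow,
      Complex.ofReal_re, Complex.ofReal_im]
    have := Real.sin_sq_add_cos_sq α
    linear_combination this - 2 * r ^ 2 * hcos
  rw [h1, h2, div_mul_div_comm, ← pow_two ‖(r : ℂ) ^ 2 - p‖, hN, hsin, ← mul_div_assoc]
  set c := Real.cos (α / 2)
  set s := Real.sin (α / 2)
  have hlow : s ^ 2 * (r ^ 2 + 1) ^ 2 ≤ (r ^ 2 + 1) ^ 2 - 4 * c ^ 2 * r ^ 2 := by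
    have : s ^ 2 = 1 - c ^ 2 := by linarith
    rw [this]
    nlinarith [mul_nonneg (sq_nonneg c) (sq_nonneg (r ^ 2 - 1))]
  have hpos : 0 < (r ^ 2 + 1) ^ 2 - 4 * c ^ 2 * r ^ 2 := lt_of_lt_of_le (by positivity) hlow
  have hup : c * r * (r ^ 2 + 2 * r * c + 1) ≤ (r ^ 2 + 1) ^ 2 := by
    have e1 : c * r ≤ (r ^ 2 + 1) / 2 := by nlinarith [sq_nonneg (r - 1)]
    have e2 : r ^ 2 + 2 * r * c + 1 ≤ 2 * (r ^ 2 + 1) := by linarith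
    calc _ ≤ ((r ^ 2 + 1) / 2) * (2 * (r ^ 2 + 1)) := by gcongr
      _ = _ := by ring
  rw [div_le_div_iff₀ hpos (by positivity)]
  calc 2 * (2 * s * c) * (r ^ 2 * (2 * (2 * s * c))) * (r ^ 2 + 2 * r * c + 1)
      = 16 * r * c * (s ^ 2 * (c * r * (r ^ 2 + 2 * r * c + 1))) := by ring
    _ ≤ 16 * r * c * (s ^ 2 * (r ^ 2 + 1) ^ 2) := by gcongr
    _ ≤ 16 * r * c * ((r ^ 2 + 1) ^ 2 - 4 * c ^ 2 * r ^ 2) := by gcongr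
    _ = _ := by ring

/-- The phase equation: if `phaseRatio α r = e^{-iθ}`, then `r² sin (θ/2) = sin (θ/2 - α)`. -/
theorem sq_mul_sin_of_phaseRatio_eq {α r θ : ℝ} (hα0 : 0 < α) (hαπ : α < Real.pi)
    (h : phaseRatio α r = Complex.exp (-(θ : ℂ) * Complex.I)) :
    r ^ 2 * Real.sin (θ / 2) = Real.sin (θ / 2 - α) := by
  rw [phaseRatio, div_eq_iff (sq_sub_exp_ne_zero hα0 hαπ r)] at h
  have h2 : Complex.exp (θ / 2 * Complex.I) ≠ 0 := Complex.exp_ne_zero _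
  have e1 : Complex.exp (-(θ : ℂ) * Complex.I) * Complex.exp (θ / 2 * Complex.I) =
      Complex.exp (-(θ / 2) * Complex.I) := by rw [← Complex.exp_add]; congr 1; ring
  have e2 : Complex.exp (-(θ / 2 : ℂ) * Complex.I) * Complex.exp (α * Complex.I) =
      Complex.exp (-(θ / 2 - α) * Complex.I) := by rw [← Complex.exp_add]; congr 1; ring
  have e3 : Complex.exp (-(α : ℂ) * Complex.I) * Complex.exp (θ / 2 * Complex.I) =
      Complex.exp ((θ / 2 - α) * Complex.I) := by rw [← Complex.exp_add]; congr 1; ring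
  have key : (r : ℂ) ^ 2 * Complex.sin (θ / 2) = Complex.sin (θ / 2 - α) := by
    rw [Complex.sin, Complex.sin]
    linear_combination (-(Complex.I / 2) * Complex.exp (θ / 2 * Complex.I)) * h +
      Complex.I / 2 * (e2 - e3) + Complex.I / 2 * (Complex.exp (α * Complex.I) - r ^ 2) * e1
  exact_mod_cast key

/-- In the equality case, the quadratic identity holds at all points of the circle off `Q`. -/
theorem circle_identity_of_eq {n : ℕ} (hn : 1 ≤ n) {α : ℝ} (hα0 : 0 < α) (hαπ : α < Real.pi)
    {Q : Set Torus} (hQ : IsCompact Q) (hvol : volume Q = ENNReal.ofReal (2 * α))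
    {f : Torus → ℝ} (hf : f ∈ trigPoly (n - 1)) {M : ℝ} (hM : M = Real.sin (α / 2) ^ (2 * n))
    (hF : ∀ t ∈ Q, |cosHarmonic n t - f t| ≤ M) {t : Torus} (ht : t ∉ Q) :
    (diskMap Q α 0 ^ (2 * n)) ^ 2 -
      2 * (cosHarmonic n t - f t : ℝ) * unitPoint t ^ n * diskMap Q α 0 ^ (2 * n) *
        diskMap Q α (unitPoint t) ^ (2 * n) +
      (M * unitPoint t ^ n) ^ 2 * (diskMap Q α (unitPoint t) ^ (2 * n)) ^ 2 = 0 := by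
  have hM0 : 0 < M := hM ▸ pow_pos (sin_half_pos hα0 hαπ) _
  obtain ⟨P, hPd, hPb, hP0, hPu⟩ := exists_polynomial_of_mem_trigPoly hn hf
  have hball : Metric.ball (0 : ℂ) 1 ⊆ (unitPoint '' Q)ᶜ := by
    rintro _ hz ⟨s, -, rfl⟩
    rw [mem_ball_zero_iff, norm_unitPoint] at hz
    exact lt_irrefl _ hz
  have hpre : IsPreconnected (Metric.ball (0 : ℂ) 1 ∪ {unitPoint t}) := by
    -- A set between the disk and its closure is connected; the boundary point is off E, so
    -- analyticity holds there too.
    refine (convex_ball (0 : ℂ) 1).isPreconnected.subset_closure Set.subset_union_left ?_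
    rw [closure_ball (0 : ℂ) one_ne_zero]
    refine Set.union_subset Metric.ball_subset_closedBall ?_
    rintro _ rfl
    rw [mem_closedBall_zero_iff, norm_unitPoint]
  have := root_identity_of_eq hn hM0 (isCompact_image_unitPoint hQ)
    ((nonempty_of_volume hα0 hvol).image _) hPd hPb (differentiableOn_diskMap hQ hα0 hαπ)
    (fun z hz => norm_diskMap_le hQ hα0 hαπ hz) (norm_diskMap_mul_le hQ hα0 hαπ hvol)
    (norm_root_le_of_abs_le hM0.le hPu hF) hP0
    (by rw [norm_diskMap_zero hα0 hαπ hvol, hM]) hpre (Or.inl (Metric.mem_ball_self one_pos))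
    (Set.union_subset hball (by
      rintro _ rfl ⟨s, hs, h⟩
      exact ht (unitPoint_injective h ▸ hs))) (Or.inr rfl : unitPoint t ∈ _)
  rwa [hPu t] at this

/-- In the equality case, the phase of the disk map on the complement of `Q`. -/
theorem phaseRatio_facts_of_eq {n : ℕ} (hn : 1 ≤ n) {α : ℝ} (hα0 : 0 < α) (hαπ : α < Real.pi)
    {Q : Set Torus} (hQ : IsCompact Q) (hvol : volume Q = ENNReal.ofReal (2 * α))
    {f : Torus → ℝ} (hf : f ∈ trigPoly (n - 1)) {M : ℝ} (hM : M = Real.sin (α / 2) ^ (2 * n))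
    (hF : ∀ t ∈ Q, |cosHarmonic n t - f t| ≤ M) {t : Torus} (ht : t ∉ Q) :
    ∃ r : ℝ, 0 < r ∧ halfPlaneMap Q (unitPoint t) = r ∧
      (unitPoint t * phaseRatio α r * Complex.exp (α * Complex.I)) ^ (2 * n) = 1 ∧
      ‖phaseRatio α r - 1‖ * ‖phaseRatio α r - Complex.exp (-(2 * α : ℝ) * Complex.I)‖ ≤
        4 * √(2 * |cosHarmonic n t - f t| / M - 2) := by
  have hid := circle_identity_of_eq hn hα0 hαπ hQ hvol hf hM hF ht
  have hs := sin_half_pos hα0 hαπ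
  have hM0 : 0 < M := hM ▸ pow_pos hs _
  have htE : unitPoint t ∉ unitPoint '' Q := by
    rintro ⟨s, hs, h⟩
    exact ht (unitPoint_injective h ▸ hs)
  obtain ⟨r, hr, hrw⟩ := halfPlaneMap_of_norm_eq_one hQ htE (norm_unitPoint t)
  obtain ⟨hB2, hBn⟩ := half_angle_identities (B := diskMap Q α (unitPoint t)) hα0 hαπ hr hrw rfl
  rw [hrw] at hB2
  set z := unitPoint t with hz
  set B := diskMap Q α z with hB
  set K := diskMap Q α 0 ^ (2 * n) with hK
  set F := cosHarmonic n t - f t with hFdef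
  set u := phaseRatio α r with hu
  have hz1 : ‖z‖ = 1 := norm_unitPoint t
  have hKn : ‖K‖ = M := by rw [hK, norm_pow, norm_diskMap_zero hα0 hαπ hvol, hM]
  have hK0 : K ≠ 0 := by rw [← norm_pos_iff, hKn]; exact hM0
  have hKsq : K ^ 2 * Complex.exp (α * Complex.I) ^ (2 * n) = (M : ℂ) ^ 2 := by
    have e1 : diskMap Q α 0 ^ 4 * Complex.exp (α * Complex.I) ^ 2 = Real.sin (α / 2) ^ 4 := by
      rw [diskMap_zero hα0 hvol, mul_pow, mul_pow, Complex.I_pow_four, one_mul, mul_assoc,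
        ← Complex.exp_nat_mul, ← Complex.exp_nat_mul, ← Complex.exp_add]
      have : ((4 : ℕ) : ℂ) * (-(α / 2 : ℝ) * Complex.I) + ((2 : ℕ) : ℂ) * (α * Complex.I) = 0 := by
        push_cast; ring
      rw [this, Complex.exp_zero, mul_one]
    calc K ^ 2 * Complex.exp (α * Complex.I) ^ (2 * n)
        = (diskMap Q α 0 ^ 4 * Complex.exp (α * Complex.I) ^ 2) ^ n := by rw [hK]; ring
      _ = (M : ℂ) ^ 2 := by rw [e1, hM]; push_cast; ring
  have hβ1 : ‖B‖ ^ 2 < 1 := by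
    have hc := cos_half_pos hα0 hαπ
    have : 0 < 1 - ‖B‖ ^ 2 := by rw [hBn]; positivity
    linarith
  set b := z ^ n * B ^ (2 * n) with hb
  have hbn : ‖b‖ = (‖B‖ ^ 2) ^ n := by
    rw [hb, norm_mul, norm_pow, hz1, one_pow, one_mul, norm_pow, pow_mul]
  have hbu : b = ‖b‖ * (z * u) ^ n := by
    rw [hbn, hb, pow_mul, hB2]; push_cast; ring
  have hb0 : b ≠ 0 := by
    intro h0
    have : K ^ 2 = 0 := by
      linear_combination hid + (2 * F * K - (M : ℂ) ^ 2 * b) * h0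
    exact hK0 (pow_eq_zero_iff two_ne_zero |>.1 this)
  have hy0 : 0 < ‖b‖ := norm_pos_iff.2 hb0
  have hyβ : ‖b‖ ≤ ‖B‖ ^ 2 := by
    rw [hbn]
    exact pow_le_of_le_one (by positivity) hβ1.le (by omega)
  have hy1 : ‖b‖ < 1 := hyβ.trans_lt hβ1
  have hX : (K / b) ^ 2 - 2 * (F : ℝ) * (K / b) + (M : ℂ) ^ 2 = 0 := by
    field_simp
    linear_combination hid
  have hXn : ‖K / b‖ = M / ‖b‖ := by rw [norm_div, hKn]
  -- Nonreal roots of the quadratic have modulus M, so this strict inequality makes K/b real. That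
  -- fixes the phase of b up to sign.
  have hXM : M < ‖K / b‖ := by rw [hXn, lt_div_iff₀ hy0]; nlinarith
  have him : (K / b).im = 0 := (im_eq_zero_or_norm_eq hM0.le hX).resolve_right hXM.ne'
  set x := (K / b).re with hx
  have hXx : K / b = x := Complex.ext (by simp [hx]) (by simp [him])
  rw [hXx] at hX hXn
  rw [Complex.norm_real, Real.norm_eq_abs] at hXn
  have hXr : x ^ 2 - 2 * F * x + M ^ 2 = 0 := by exact_mod_cast hX
  have hKx : K = x * b := by rw [← hXx, div_mul_cancel₀ _ hb0]
  have hxb : x ^ 2 * ‖b‖ ^ 2 = M ^ 2 := by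
    rw [← sq_abs, hXn]; field_simp
  refine ⟨r, hr, hrw, ?_, ?_⟩
  · have hxb' : (x : ℂ) ^ 2 * (‖b‖ : ℂ) ^ 2 = (M : ℂ) ^ 2 := by exact_mod_cast hxb
    have hM2 : (M : ℂ) ^ 2 ≠ 0 := pow_ne_zero 2 (Complex.ofReal_ne_zero.2 hM0.ne')
    refine mul_left_cancel₀ hM2 ?_
    calc (M : ℂ) ^ 2 * (z * u * Complex.exp (α * Complex.I)) ^ (2 * n)
        = ((x : ℂ) * (‖b‖ * (z * u) ^ n)) ^ 2 * Complex.exp (α * Complex.I) ^ (2 * n) := by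
          rw [← hxb']; ring
      _ = (M : ℂ) ^ 2 * 1 := by rw [← hbu, ← hKx, hKsq, mul_one]
  · refine (norm_phaseRatio_mul_le hα0 hαπ hr).trans ?_
    rw [← hBn]
    refine mul_le_mul_of_nonneg_left ?_ (by norm_num)
    refine (sub_le_sub_left hyβ 1).trans (Real.le_sqrt_of_sq_le ?_)
    have hx0 : 0 < |x| := by rw [hXn]; positivity
    have hFx : 2 * |F| * |x| = |x| ^ 2 + M ^ 2 := by
      have : 2 * F * x = x ^ 2 + M ^ 2 := by linarith
      rw [sq_abs, ← this, mul_assoc, ← abs_mul, mul_assoc, abs_of_nonneg]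
      nlinarith [sq_nonneg x, sq_nonneg M]
    have hFM : 2 * |F| / M = 1 / ‖b‖ + ‖b‖ := by
      rw [hXn] at hFx
      field_simp at hFx ⊢
      linarith
    rw [hFM, ← sub_nonneg]
    -- X + M²/X = 2F with |X| = M/|b| gives 2|F|/M - 2 = (1 - |b|)²/|b|, which is at least (1 -
    -- |b|)²; and |b| = |B|^{2n} ≤ |B|².
    have : 1 / ‖b‖ + ‖b‖ - 2 - (1 - ‖b‖) ^ 2 = (1 - ‖b‖) ^ 3 / ‖b‖ := by field_simp; ring
    rw [this]
    have : 0 ≤ 1 - ‖b‖ := by linarith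
    positivity

theorem continuous_cosHarmonic (k : ℕ) : Continuous (cosHarmonic k) := by
  have : cosHarmonic k = fun t => (unitPoint t ^ k).re := by
    ext t; rw [unitPoint_pow]; simp
  rw [this]
  exact Complex.continuous_re.comp (continuous_unitPoint.pow k)

theorem continuous_sinHarmonic (k : ℕ) : Continuous (sinHarmonic k) := by
  have : sinHarmonic k = fun t => (unitPoint t ^ k).im := by
    ext t; rw [unitPoint_pow]; simp
  rw [this]
  exact Complex.continuous_im.comp (continuous_unitPoint.pow k)

theorem continuous_of_mem_trigPoly {m : ℕ} {f : Torus → ℝ} (hf : f ∈ trigPoly m) :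
    Continuous f := by
  obtain ⟨a, b, h⟩ := hf
  rw [funext h]
  have := continuous_cosHarmonic
  have := continuous_sinHarmonic
  fun_prop

theorem finite_setOf_pow_eq_one {N : ℕ} (hN : 0 < N) : {w : ℂ | w ^ N = 1}.Finite := by
  refine (Polynomial.nthRoots N (1 : ℂ)).toFinset.finite_toSet.subset fun w hw => ?_
  simpa [Polynomial.mem_nthRoots hN] using hw

/-- In the equality case every gap of `Q` has length `2π - 2α`, and its position is determined. -/
theorem gap_of_eq {n : ℕ} (hn : 1 ≤ n) {α : ℝ} (hα0 : 0 < α) (hαπ : α < Real.pi)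
    {Q : Set Torus} (hQ : IsCompact Q) (hvol : volume Q = ENNReal.ofReal (2 * α))
    {f : Torus → ℝ} (hf : f ∈ trigPoly (n - 1)) {M : ℝ} (hM : M = Real.sin (α / 2) ^ (2 * n))
    (hF : ∀ t ∈ Q, |cosHarmonic n t - f t| ≤ M) {a b : ℝ} (hab : a < b)
    (hba : b ≤ a + 2 * Real.pi) (ha : (a : Torus) ∈ Q) (hb : (b : Torus) ∈ Q)
    (hgap : ∀ x ∈ Set.Ioo a b, (x : Torus) ∉ Q) :
    b = a + 2 * Real.pi - 2 * α ∧ ∃ k : ℤ, a = α + k * Real.pi / n := by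
  have hM0 : 0 < M := hM ▸ pow_pos (sin_half_pos hα0 hαπ) _
  have hsinα := Real.sin_pos_of_pos_of_lt_pi hα0 hαπ
  have hfacts := fun x (hx : x ∈ Set.Ioo a b) =>
    phaseRatio_facts_of_eq hn hα0 hαπ hQ hvol hf hM hF (hgap x hx)
  set U : ℝ → ℂ := fun x => phaseRatio α (halfPlaneMap Q (unitPoint (x : Torus))) with hU
  set V : ℝ → ℂ := fun x => unitPoint (x : Torus) * U x * Complex.exp (α * Complex.I) with hV
  have hcoe : Continuous fun x : ℝ => unitPoint (x : Torus) :=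
    continuous_unitPoint.comp (AddCircle.continuous_mk' _)
  have hUc : ContinuousOn U (Set.Ioo a b) := by
    have h1 : ContinuousOn (halfPlaneMap Q) (unitPoint '' Q)ᶜ :=
      (((differentiableOn_herglotz hQ).const_mul Complex.I).div_const 4).cexp.continuousOn
    have h2 : ContinuousOn (fun x : ℝ => halfPlaneMap Q (unitPoint (x : Torus))) (Set.Ioo a b) := by
      refine h1.comp hcoe.continuousOn fun x hx => ?_
      rintro ⟨s, hs, h⟩
      exact hgap x hx (unitPoint_injective h ▸ hs)
    refine ((h2.pow 2).sub continuousOn_const).div ((h2.pow 2).sub continuousOn_const)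
      fun x hx => ?_
    obtain ⟨r, -, h3, -⟩ := hfacts x hx
    rw [h3]
    exact sq_sub_exp_ne_zero hα0 hαπ r
  have hVc : ContinuousOn V (Set.Ioo a b) :=
    (hcoe.continuousOn.mul hUc).mul continuousOn_const
  have hV1 : Set.MapsTo V (Set.Ioo a b) {w : ℂ | w ^ (2 * n) = 1} := by
    intro x hx
    obtain ⟨r, -, h3, h4, -⟩ := hfacts x hx
    change V x ^ (2 * n) = 1
    simpa only [hV, hU, h3] using h4
  have hfin : {w : ℂ | w ^ (2 * n) = 1}.Finite := finite_setOf_pow_eq_one (by omega)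
  set x₀ := (a + b) / 2 with hx₀
  have hx₀m : x₀ ∈ Set.Ioo a b := ⟨by rw [hx₀]; linarith, by rw [hx₀]; linarith⟩
  -- A continuous function on an interval with values among the 2n-th roots of unity is constant.
  have hVconst : ∀ x ∈ Set.Ioo a b, V x = V x₀ := fun x hx =>
    isPreconnected_Ioo.constant_of_mapsTo hfin.isDiscrete hVc hV1 hx hx₀m
  set ω : ℂ := V x₀ * Complex.exp (-(α : ℂ) * Complex.I) with hω
  have hUω : ∀ x ∈ Set.Ioo a b, U x = ω * Complex.exp (-(x : ℂ) * Complex.I) := by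
    intro x hx
    rw [hω, ← hVconst x hx]
    simp only [hV, unitPoint_coe]
    have e1 : Complex.exp (x * Complex.I) * Complex.exp (-(x : ℂ) * Complex.I) = 1 := by
      rw [← Complex.exp_add]; simp
    have e2 : Complex.exp (α * Complex.I) * Complex.exp (-(α : ℂ) * Complex.I) = 1 := by
      rw [← Complex.exp_add]; simp
    linear_combination (-U x) * e1 - (U x * Complex.exp (x * Complex.I) *
      Complex.exp (-(x : ℂ) * Complex.I)) * e2
  set L : ℝ → ℝ := fun x => ‖ω * Complex.exp (-(x : ℂ) * Complex.I) - 1‖ *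
    ‖ω * Complex.exp (-(x : ℂ) * Complex.I) - Complex.exp (-(2 * α : ℝ) * Complex.I)‖ with hL
  set R : ℝ → ℝ := fun x => 4 * √(2 * |cosHarmonic n (x : Torus) - f (x : Torus)| / M - 2) with hR
  have hLc : Continuous L := by fun_prop
  have hRc : Continuous R := by
    have h1 : Continuous fun x : ℝ => cosHarmonic n (x : Torus) :=
      (continuous_cosHarmonic n).comp (AddCircle.continuous_mk' _)
    have h2 : Continuous fun x : ℝ => f (x : Torus) :=
      (continuous_of_mem_trigPoly hf).comp (AddCircle.continuous_mk' _)
    exact continuous_const.mul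
      (((continuous_const.mul (h1.sub h2).abs).div_const M).sub continuous_const).sqrt
  have hLR : ∀ x ∈ Set.Ioo a b, L x ≤ R x := by
    intro x hx
    obtain ⟨r, -, h3, -, h4⟩ := hfacts x hx
    rw [← h3] at h4
    change ‖U x - 1‖ * ‖U x - _‖ ≤ _ at h4
    rwa [hUω x hx] at h4
  have hend : ∀ x ∈ Set.Icc a b, (x : Torus) ∈ Q →
      ω * Complex.exp (-(x : ℂ) * Complex.I) = 1 ∨
      ω * Complex.exp (-(x : ℂ) * Complex.I) = Complex.exp (-(2 * α : ℝ) * Complex.I) := by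
    intro x hx hxQ
    -- Both sides are continuous on all of ℝ, so the estimate extends to the ends of the gap without
    -- any limit of B being known.
    have h1 : L x ≤ R x := le_on_closure hLR hLc.continuousOn hRc.continuousOn
      (by rwa [closure_Ioo hab.ne])
    have h2 : R x = 0 := by
      simp only [hR]
      -- On Q the radicand is nonpositive, and the real square root is 0 there.
      rw [Real.sqrt_eq_zero_of_nonpos, mul_zero]
      rw [sub_nonpos, div_le_iff₀ hM0]
      linarith [hF _ hxQ]
    have h3 : L x = 0 := le_antisymm (h2 ▸ h1) (by positivity)
    rcases mul_eq_zero.1 h3 with h | h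
    · exact Or.inl (sub_eq_zero.1 (norm_eq_zero.1 h))
    · exact Or.inr (sub_eq_zero.1 (norm_eq_zero.1 h))
  have hsolve : ∀ x ∈ Set.Ioo a b, ∀ θ : ℝ,
      ω * Complex.exp (-(x : ℂ) * Complex.I) = Complex.exp (-(θ : ℂ) * Complex.I) →
      ∃ r : ℝ, 0 < r ∧ r ^ 2 * Real.sin (θ / 2) = Real.sin (θ / 2 - α) := by
    intro x hx θ h
    obtain ⟨r, hr, h3, -⟩ := hfacts x hx
    refine ⟨r, hr, sq_mul_sin_of_phaseRatio_eq hα0 hαπ ?_⟩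
    rw [← h, ← hUω x hx, ← h3]
  have hmove : ∀ (x θ : ℝ), ω * Complex.exp (-(a : ℂ) * Complex.I) =
      Complex.exp (-(θ : ℂ) * Complex.I) → ω * Complex.exp (-(x : ℂ) * Complex.I) =
      Complex.exp (-((θ + (x - a) : ℝ) : ℂ) * Complex.I) := by
    intro x θ h
    have e1 : Complex.exp (-(x : ℂ) * Complex.I) =
        Complex.exp (-(a : ℂ) * Complex.I) * Complex.exp (-((x - a : ℝ) : ℂ) * Complex.I) := by
      rw [← Complex.exp_add]; congr 1; push_cast; ring
    rw [e1, ← mul_assoc, h, ← Complex.exp_add]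
    congr 1; push_cast; ring
  -- The value 1 at the left end is impossible: just to its right the phase equation would read r²
  -- sin(d/2) = sin(d/2 - α) with opposite signs. The choice of d keeps the point in the gap and d ≤
  -- α.
  rcases hend a (Set.left_mem_Icc.2 hab.le) ha with h0 | h0
  · exfalso
    set d := min (b - a) (2 * α) / 2 with hd
    have hd0 : 0 < d := by rw [hd]; have := lt_min (sub_pos.2 hab) (by linarith : 0 < 2 * α); linarith
    have hd1 : d < b - a := by rw [hd]; have := min_le_left (b - a) (2 * α); linarith
    have hd2 : d ≤ α := by rw [hd]; have := min_le_right (b - a) (2 * α); linarith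
    obtain ⟨r, hr, h1⟩ := hsolve (a + d) ⟨by linarith, by linarith⟩ d (by
      have := hmove (a + d) 0 (by simpa using h0)
      simpa using this)
    have h2 : 0 < Real.sin (d / 2) := Real.sin_pos_of_pos_of_lt_pi (by linarith) (by linarith)
    have h3 : Real.sin (d / 2 - α) < 0 :=
      Real.sin_neg_of_neg_of_neg_pi_lt (by linarith) (by linarith)
    nlinarith [mul_pos (pow_pos hr 2) h2]
  have hmv := fun x => hmove x (2 * α) h0
  have hle : b ≤ a + 2 * Real.pi - 2 * α := by
    by_contra hcon
    push Not at hcon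
    -- If the gap were longer, the phase would reach θ = 2π inside it, where the equation reads 0 =
    -- sin(π - α).
    obtain ⟨r, hr, h1⟩ := hsolve (a + 2 * Real.pi - 2 * α) ⟨by linarith, hcon⟩ (2 * Real.pi) (by
      rw [hmv]; congr 2; push_cast; ring)
    rw [mul_div_cancel_left₀ _ (two_ne_zero' ℝ), Real.sin_pi, Real.sin_pi_sub] at h1
    linarith
  refine ⟨le_antisymm hle ?_, ?_⟩
  · have hexp : ∀ y : ℝ, 0 < y → Complex.exp (-(y : ℂ) * Complex.I) = 1 → 2 * Real.pi ≤ y := by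
      intro y hy h
      obtain ⟨m, hm⟩ := Complex.exp_eq_one_iff.1 h
      have h1 : -y = m * (2 * Real.pi) := by
        have := congrArg Complex.im hm
        simpa using this
      have hm0 : m < 0 := by
        by_contra hc
        push Not at hc
        have : (0 : ℝ) ≤ m := by exact_mod_cast hc
        nlinarith [Real.pi_pos]
      have : (m : ℝ) ≤ -1 := by exact_mod_cast Int.le_sub_one_of_lt hm0
      nlinarith [Real.pi_pos]
    -- Starting from e^{-2iα}, the rotating phase reaches 1 only after length at least 2π - 2α, and
    -- returns to e^{-2iα} only after at least 2π.
    rcases hend b (Set.right_mem_Icc.2 hab.le) hb with h1 | h1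
    · rw [hmv] at h1
      linarith [hexp _ (by linarith) h1]
    · rw [hmv] at h1
      have h2 : Complex.exp (-((b - a : ℝ) : ℂ) * Complex.I) = 1 := by
        have e : Complex.exp (-((2 * α + (b - a) : ℝ) : ℂ) * Complex.I) =
            Complex.exp (-(2 * α : ℝ) * Complex.I) *
              Complex.exp (-((b - a : ℝ) : ℂ) * Complex.I) := by
          rw [← Complex.exp_add]; congr 1; push_cast; ring
        rw [e] at h1
        exact mul_left_cancel₀ (Complex.exp_ne_zero _) (h1.trans (mul_one _).symm)
      linarith [hexp _ (by linarith) h2]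
  -- The constant value is computed at the left end; being a 2n-th root of unity, it places a - α in
  -- (π/n)ℤ.
  · have hv : V x₀ = Complex.exp ((a - α : ℝ) * Complex.I) := by
      have e1 : V x₀ = ω * Complex.exp (-(a : ℂ) * Complex.I) *
          (Complex.exp (a * Complex.I) * Complex.exp (α * Complex.I)) := by
        rw [hω, mul_assoc (V x₀), ← Complex.exp_add, mul_assoc, ← Complex.exp_add,
          ← Complex.exp_add]
        have : -(α : ℂ) * Complex.I + -(a : ℂ) * Complex.I +
          (a * Complex.I + α * Complex.I) = 0 := by ring
        rw [this, Complex.exp_zero, mul_one]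
      rw [e1, h0, ← Complex.exp_add, ← Complex.exp_add]
      congr 1; push_cast; ring
    have h1 : V x₀ ^ (2 * n) = 1 := hV1 hx₀m
    rw [hv, ← Complex.exp_nat_mul] at h1
    obtain ⟨k, hk⟩ := Complex.exp_eq_one_iff.1 h1
    refine ⟨k, ?_⟩
    have h2 : 2 * n * (a - α) = k * (2 * Real.pi) := by
      have := congrArg Complex.im hk
      simpa using this
    have hn0 : (n : ℝ) ≠ 0 := by positivity
    field_simp
    linarith

/-! ### From one gap to the whole set. -/

theorem volume_eq_volume_preimage_inter {S : Set Torus} (hS : MeasurableSet S) (a : ℝ) :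
    volume S = volume (((↑) : ℝ → Torus) ⁻¹' S ∩ Set.Ioc a (a + 2 * Real.pi)) :=
  AddCircle.add_projection_respects_measure (2 * Real.pi) a hS

theorem coe_add_two_pi (x : ℝ) : ((x + 2 * Real.pi : ℝ) : Torus) = x :=
  AddCircle.coe_add_period _ x

theorem coe_add_int_mul_two_pi (x : ℝ) (k : ℤ) :
    ((x + k * (2 * Real.pi) : ℝ) : Torus) = x := by
  rw [AddCircle.coe_add, ← zsmul_eq_mul, AddCircle.coe_zsmul, AddCircle.coe_period, smul_zero,
    add_zero]

theorem isCompact_torusSegment (n : ℕ) (α : ℝ) (k : ℤ) : IsCompact (torusSegment n α k) :=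
  isCompact_Icc.image (AddCircle.continuous_mk' _)

theorem volume_torusSegment (n : ℕ) {α : ℝ} (hαπ : α < Real.pi) (k : ℤ) :
    volume (torusSegment n α k) = ENNReal.ofReal (2 * α) := by
  have hm := (isCompact_torusSegment n α k).isClosed.measurableSet
  set c := k * Real.pi / n with hc
  have hI : Set.Icc (-α + c) (α + c) ⊆ Set.Ioc (α + c - 2 * Real.pi) (α + c - 2 * Real.pi +
      2 * Real.pi) := fun x hx => ⟨by linarith [hx.1], by linarith [hx.2]⟩
  rw [volume_eq_volume_preimage_inter hm (α + c - 2 * Real.pi)]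
  have : ((↑) : ℝ → Torus) ⁻¹' torusSegment n α k ∩
      Set.Ioc (α + c - 2 * Real.pi) (α + c - 2 * Real.pi + 2 * Real.pi) =
      Set.Icc (-α + c) (α + c) := by
    refine Set.Subset.antisymm ?_ fun x hx => ⟨⟨x, hx, rfl⟩, hI hx⟩
    rintro x ⟨⟨y, hy, hyx⟩, hx⟩
    rwa [← (AddCircle.coe_eq_coe_iff_of_mem_Ioc (hI hy) hx).1 hyx]
  rw [this, Real.volume_Icc]
  congr 1
  ring

/-- A proper nonempty closed subset of the torus has a gap. -/
theorem exists_gap {Q : Set Torus} (hQ : IsClosed Q) (hne : Q.Nonempty) (huniv : Q ≠ Set.univ) :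
    ∃ a b : ℝ, a < b ∧ b ≤ a + 2 * Real.pi ∧ (a : Torus) ∈ Q ∧ (b : Torus) ∈ Q ∧
      ∀ x ∈ Set.Ioo a b, (x : Torus) ∉ Q := by
  have hpi := Real.two_pi_pos
  have hcl : IsClosed (((↑) : ℝ → Torus) ⁻¹' Q) := hQ.preimage (AddCircle.continuous_mk' _)
  obtain ⟨t, ht⟩ := (Set.ne_univ_iff_exists_notMem Q).1 huniv
  obtain ⟨x₁, rfl⟩ := QuotientAddGroup.mk_surjective t
  obtain ⟨s, hs⟩ := hne
  obtain ⟨y, rfl⟩ := QuotientAddGroup.mk_surjective s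
  -- The gap is bounded by the points of the periodic lift of Q nearest to x₁ on either side.
  set A := ((↑) : ℝ → Torus) ⁻¹' Q ∩ Set.Iic x₁ with hA
  set B := ((↑) : ℝ → Torus) ⁻¹' Q ∩ Set.Ici x₁ with hB
  have hshift : ∀ k : ℤ, ((y + k * (2 * Real.pi) : ℝ) : Torus) ∈ Q := fun k => by
    rw [coe_add_int_mul_two_pi]; exact hs
  have hAne : A.Nonempty := by
    refine ⟨y + (⌊(x₁ - y) / (2 * Real.pi)⌋ : ℤ) * (2 * Real.pi), hshift _, ?_⟩
    have := Int.floor_le ((x₁ - y) / (2 * Real.pi))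
    rw [le_div_iff₀ hpi] at this
    rw [Set.mem_Iic]; linarith
  have hBne : B.Nonempty := by
    refine ⟨y + (⌈(x₁ - y) / (2 * Real.pi)⌉ : ℤ) * (2 * Real.pi), hshift _, ?_⟩
    have := Int.le_ceil ((x₁ - y) / (2 * Real.pi))
    rw [div_le_iff₀ hpi] at this
    rw [Set.mem_Ici]; linarith
  have hAb : BddAbove A := ⟨x₁, fun x hx => hx.2⟩
  have hBb : BddBelow B := ⟨x₁, fun x hx => hx.2⟩
  have ha : sSup A ∈ A := (hcl.inter isClosed_Iic).csSup_mem hAne hAb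
  have hb : sInf B ∈ B := (hcl.inter isClosed_Ici).csInf_mem hBne hBb
  have ha1 : sSup A < x₁ := lt_of_le_of_ne ha.2 fun h => ht (h ▸ ha.1)
  have hb1 : x₁ < sInf B := lt_of_le_of_ne hb.2 fun h => ht (h ▸ hb.1)
  refine ⟨sSup A, sInf B, ha1.trans hb1, ?_, ha.1, hb.1, fun x hx hxQ => ?_⟩
  · have hmem : ((sSup A + 2 * Real.pi : ℝ) : Torus) ∈ Q := by rw [coe_add_two_pi]; exact ha.1
    rcases le_total x₁ (sSup A + 2 * Real.pi) with h | h
    · exact csInf_le hBb ⟨hmem, h⟩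
    · have := le_csSup hAb (⟨hmem, h⟩ : sSup A + 2 * Real.pi ∈ A)
      linarith
  · rcases le_total x x₁ with h | h
    · exact absurd (le_csSup hAb ⟨hxQ, h⟩) (not_le.2 hx.1)
    · exact absurd (csInf_le hBb ⟨hxQ, h⟩) (not_le.2 hx.2)

theorem eq_torusSegment_of_eq {n : ℕ} (hn : 1 ≤ n) {α : ℝ} (hα0 : 0 < α) (hαπ : α < Real.pi)
    {Q : Set Torus} (hQ : IsCompact Q) (hvol : volume Q = ENNReal.ofReal (2 * α))
    {f : Torus → ℝ} (hf : f ∈ trigPoly (n - 1))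
    (hF : ∀ t ∈ Q, |cosHarmonic n t - f t| ≤ Real.sin (α / 2) ^ (2 * n)) :
    ∃ k : ℤ, Q = torusSegment n α k := by
  have huniv : Q ≠ Set.univ := by
    rintro rfl
    rw [AddCircle.measure_univ, ENNReal.ofReal_eq_ofReal_iff Real.two_pi_pos.le (by linarith)]
      at hvol
    linarith
  obtain ⟨a, b, hab, hba, ha, hb, hgap⟩ :=
    exists_gap hQ.isClosed (nonempty_of_volume hα0 hvol) huniv
  obtain ⟨hbeq, k, hk⟩ := gap_of_eq hn hα0 hαπ hQ hvol hf rfl hF hab hba ha hb hgap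
  refine ⟨k, ?_⟩
  have hseg : torusSegment n α k = (fun x : ℝ => (x : Torus)) '' Set.Icc (a - 2 * α) a := by
    rw [torusSegment, hk]
    congr 2
    ring
  have hpre : ((↑) : ℝ → Torus) ⁻¹' Q ∩ Set.Ioc (a - 2 * Real.pi) (a - 2 * Real.pi + 2 * Real.pi)
      ⊆ Set.Icc (a - 2 * α) a := by
    rintro y ⟨hyQ, hy⟩
    refine ⟨?_, by linarith [hy.2]⟩
    by_contra hc
    refine hgap (y + 2 * Real.pi) ⟨by linarith [hy.1], by linarith⟩ ?_
    rw [coe_add_two_pi]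
    exact hyQ
  rw [hseg]
  refine Set.Subset.antisymm (fun t ht => ?_) ?_
  · have h1 : t ∈ ((↑) : ℝ → Torus) '' Set.Ioc (a - 2 * Real.pi)
        (a - 2 * Real.pi + 2 * Real.pi) := by
      rw [AddCircle.coe_image_Ioc_eq]; exact Set.mem_univ t
    obtain ⟨y, hy, rfl⟩ := h1
    exact ⟨y, hpre ⟨ht, hy⟩, rfl⟩
  · rintro _ ⟨x, hx, rfl⟩
    by_contra hxQ
    have hop : IsOpen (((↑) : ℝ → Torus) ⁻¹' Q)ᶜ :=
      (hQ.isClosed.preimage (AddCircle.continuous_mk' _)).isOpen_compl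
    obtain ⟨ε, hε, hball⟩ := Metric.isOpen_iff.1 hop x hxQ
    -- A missing point costs an open interval of positive length inside the arc. The truncation
    -- allows for x being an end of the arc, so J need not contain x.
    set J := Set.Ioo (max (a - 2 * α) (x - ε)) (min a (x + ε)) with hJ
    have hJI : J ⊆ Set.Icc (a - 2 * α) a := fun y hy =>
      ⟨(le_max_left _ _).trans hy.1.le, hy.2.le.trans (min_le_left _ _)⟩
    have hJQ : ∀ y ∈ J, (y : Torus) ∉ Q := by
      intro y hy
      refine hball ?_
      rw [Real.ball_eq_Ioo]
      exact ⟨(le_max_right _ _).trans_lt hy.1, hy.2.trans_le (min_le_right _ _)⟩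
    have hJpos : 0 < volume J := by
      rw [hJ, Real.volume_Ioo, ENNReal.ofReal_pos, sub_pos]
      refine max_lt (lt_min (by linarith) (by linarith [hx.1])) (lt_min (by linarith [hx.2]) ?_)
      linarith
    have hle : volume Q ≤ volume (Set.Icc (a - 2 * α) a \ J) := by
      rw [volume_eq_volume_preimage_inter hQ.isClosed.measurableSet (a - 2 * Real.pi)]
      exact measure_mono fun y hy => ⟨hpre hy, fun hyJ => hJQ y hyJ hy.1⟩
    have hvI : volume (Set.Icc (a - 2 * α) a) = volume Q := by
      rw [hvol, Real.volume_Icc]; congr 1; ring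
    have hlt : volume (Set.Icc (a - 2 * α) a \ J) < volume (Set.Icc (a - 2 * α) a) := by
      have hJtop : volume J ≠ ⊤ := measure_Ioo_lt_top.ne
      rw [measure_sdiff hJI measurableSet_Ioo.nullMeasurableSet hJtop]
      refine ENNReal.sub_lt_self measure_Icc_lt_top.ne ?_ hJpos.ne'
      rw [hvI, hvol, ne_eq, ENNReal.ofReal_eq_zero]
      linarith
    rw [hvI] at hlt
    exact absurd hle (not_le.2 hlt)

/-! ### The extremal polynomial for a segment. -/

/-- Trigonometric polynomials of order at most `m` as a linear subspace. -/
def trigSubmodule (m : ℕ) : Submodule ℝ (Torus → ℝ) where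
  carrier := trigPoly m
  zero_mem' := ⟨0, 0, fun t => by simp⟩
  add_mem' := by
    rintro f g ⟨a, b, hf⟩ ⟨a', b', hg⟩
    refine ⟨a + a', b + b', fun t => ?_⟩
    simp only [Pi.add_apply, hf t, hg t, add_mul, Finset.sum_add_distrib]
    ring
  smul_mem' := by
    rintro c f ⟨a, b, hf⟩
    refine ⟨c • a, c • b, fun t => ?_⟩
    simp only [Pi.smul_apply, smul_eq_mul, hf t, mul_add, Finset.mul_sum, mul_assoc]
    ring

theorem cosHarmonic_zero (t : Torus) : cosHarmonic 0 t = 1 := by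
  obtain ⟨x, rfl⟩ := QuotientAddGroup.mk_surjective t
  exact (cosHarmonic_coe 0 x).trans (by simp)

theorem sinHarmonic_zero (t : Torus) : sinHarmonic 0 t = 0 := by
  obtain ⟨x, rfl⟩ := QuotientAddGroup.mk_surjective t
  exact (sinHarmonic_coe 0 x).trans (by simp)

theorem cosHarmonic_mem_trigSubmodule {k m : ℕ} (hk : k ≤ m) :
    cosHarmonic k ∈ trigSubmodule m := by
  rcases Nat.eq_zero_or_pos k with rfl | h
  · refine ⟨fun j => if j = 0 then 2 else 0, 0, fun t => ?_⟩
    rw [Finset.sum_eq_zero, cosHarmonic_zero]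
    · simp
    · intro j hj
      rw [Finset.mem_Icc] at hj
      simp [show j ≠ 0 by omega]
  · refine ⟨fun j => if j = k then 1 else 0, 0, fun t => ?_⟩
    simp [h.ne, h.ne', hk]

theorem sinHarmonic_mem_trigSubmodule {k m : ℕ} (hk : k ≤ m) :
    sinHarmonic k ∈ trigSubmodule m := by
  rcases Nat.eq_zero_or_pos k with rfl | h
  · rw [show sinHarmonic 0 = 0 from funext sinHarmonic_zero]
    exact Submodule.zero_mem _
  · refine ⟨0, fun j => if j = k then 1 else 0, fun t => ?_⟩
    simp [h.ne', hk]

theorem eq_sum_of_trigPoly {m : ℕ} {f : Torus → ℝ} {a b : ℕ → ℝ}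
    (h : ∀ t, f t = a 0 / 2 +
      ∑ k ∈ Finset.Icc 1 m, (a k * cosHarmonic k t + b k * sinHarmonic k t)) :
    f = (a 0 / 2) • cosHarmonic 0 +
      ∑ k ∈ Finset.Icc 1 m, (a k • cosHarmonic k + b k • sinHarmonic k) := by
  ext t
  simp [h t, cosHarmonic_zero]

theorem trigSubmodule_mono {m m' : ℕ} (hm : m ≤ m') : trigSubmodule m ≤ trigSubmodule m' := by
  rintro f ⟨a, b, hf⟩
  rw [eq_sum_of_trigPoly hf]
  refine Submodule.add_mem _ (Submodule.smul_mem _ _ (cosHarmonic_mem_trigSubmodule (Nat.zero_le _)))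
    (Submodule.sum_mem _ fun k hk => ?_)
  rw [Finset.mem_Icc] at hk
  exact Submodule.add_mem _
    (Submodule.smul_mem _ _ (cosHarmonic_mem_trigSubmodule (hk.2.trans hm)))
    (Submodule.smul_mem _ _ (sinHarmonic_mem_trigSubmodule (hk.2.trans hm)))

/-- The translated harmonic `cos k(t - c)`. -/
def cosShift (c : ℝ) (k : ℕ) (t : Torus) : ℝ :=
  Real.cos (k * c) * cosHarmonic k t + Real.sin (k * c) * sinHarmonic k t

theorem cosShift_coe (c : ℝ) (k : ℕ) (x : ℝ) :
    cosShift c k (x : Torus) = Real.cos (k * (x - c)) := by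
  rw [cosShift, cosHarmonic_coe, sinHarmonic_coe, mul_sub, Real.cos_sub]
  ring

theorem eval_T_cosShift (c : ℝ) (k : ℕ) (t : Torus) :
    (Polynomial.Chebyshev.T ℝ k).eval (cosShift c 1 t) = cosShift c k t := by
  obtain ⟨x, rfl⟩ := QuotientAddGroup.mk_surjective t
  have h1 : cosShift c 1 (x : Torus) = Real.cos (x - c) := by rw [cosShift_coe]; simp
  have h2 := cosShift_coe c k x
  change (Polynomial.Chebyshev.T ℝ k).eval (cosShift c 1 (x : Torus)) = cosShift c k (x : Torus)
  rw [h1, h2, Polynomial.Chebyshev.T_real_cos]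
  norm_cast

theorem cosShift_mem_trigSubmodule (c : ℝ) {k m : ℕ} (hk : k ≤ m) :
    cosShift c k ∈ trigSubmodule m :=
  Submodule.add_mem _ (Submodule.smul_mem _ (Real.cos (k * c)) (cosHarmonic_mem_trigSubmodule hk))
    (Submodule.smul_mem _ (Real.sin (k * c)) (sinHarmonic_mem_trigSubmodule hk))

/-- Induction on the degree: the top coefficient is removed by a multiple of a Chebyshev polynomial,
whose value at cos(t - c) is a single shifted harmonic. -/
theorem eval_cosShift_mem_trigSubmodule (c : ℝ) {m : ℕ} {p : Polynomial ℝ}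
    (hp : p.natDegree ≤ m) : (fun t => p.eval (cosShift c 1 t)) ∈ trigSubmodule m := by
  induction m generalizing p with
  | zero =>
    rw [Polynomial.eq_C_of_natDegree_le_zero hp]
    have : (fun t => (Polynomial.C (p.coeff 0)).eval (cosShift c 1 t)) =
        p.coeff 0 • cosHarmonic 0 := by
      ext t; simp [cosHarmonic_zero]
    rw [this]
    exact Submodule.smul_mem _ _ (cosHarmonic_mem_trigSubmodule le_rfl)
  | succ m ih =>
    set T := Polynomial.Chebyshev.T ℝ ((m + 1 : ℕ) : ℤ) with hT
    have hTd : T.natDegree = m + 1 := by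
      rw [hT, Polynomial.Chebyshev.natDegree_T, Int.natAbs_natCast]
    have hTl : T.coeff (m + 1) ≠ 0 := by
      rw [← hTd, Polynomial.coeff_natDegree, Polynomial.leadingCoeff_ne_zero]
      exact Polynomial.Chebyshev.T_ne_zero ℝ _
    set q := p - Polynomial.C (p.coeff (m + 1) / T.coeff (m + 1)) * T with hq
    have hqd : q.natDegree ≤ m := by
      rw [Polynomial.natDegree_le_iff_coeff_eq_zero]
      intro N hN
      rcases Nat.lt_or_ge (m + 1) N with h | h
      · rw [hq, Polynomial.coeff_sub, Polynomial.coeff_C_mul,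
          Polynomial.coeff_eq_zero_of_natDegree_lt (hp.trans_lt h),
          Polynomial.coeff_eq_zero_of_natDegree_lt (hTd.trans_lt h)]
        simp
      · obtain rfl : N = m + 1 := by omega
        rw [hq, Polynomial.coeff_sub, Polynomial.coeff_C_mul, div_mul_cancel₀ _ hTl, sub_self]
    have h1 := trigSubmodule_mono (Nat.le_succ m) (ih hqd)
    have h2 := Submodule.smul_mem _ (p.coeff (m + 1) / T.coeff (m + 1))
      (cosShift_mem_trigSubmodule c (le_refl (m + 1)))
    have h3 : (fun t => p.eval (cosShift c 1 t)) = (fun t => q.eval (cosShift c 1 t)) +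
        (p.coeff (m + 1) / T.coeff (m + 1)) • cosShift c (m + 1) := by
      ext t
      simp only [Pi.add_apply, Pi.smul_apply, smul_eq_mul, hq]
      rw [← eval_T_cosShift c (m + 1) t]
      simp only [Polynomial.eval_sub, Polynomial.eval_mul, Polynomial.eval_C]
      ring
    rw [h3]
    exact Submodule.add_mem _ h1 h2

/-- The extremal polynomial for a segment. -/
theorem exists_trigPoly_le_of_torusSegment {n : ℕ} (hn : 1 ≤ n) {α : ℝ} (hα0 : 0 < α)
    (hαπ : α < Real.pi) (k : ℤ) : ∃ f ∈ trigPoly (n - 1), ∀ t ∈ torusSegment n α k,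
      |cosHarmonic n t - f t| ≤ Real.sin (α / 2) ^ (2 * n) := by
  set c := k * Real.pi / n with hc
  set S := Real.sin (α / 2) with hS
  set C := Real.cos (α / 2) with hC
  have hs : 0 < S := sin_half_pos hα0 hαπ
  have hsc : S ^ 2 + C ^ 2 = 1 := Real.sin_sq_add_cos_sq _
  have hcosα : Real.cos α = C ^ 2 - S ^ 2 := by
    have h := Real.cos_two_mul (α / 2)
    rw [mul_div_cancel₀ _ (two_ne_zero' ℝ)] at h
    rw [h]; linarith
  set T := Polynomial.Chebyshev.T ℝ (n : ℤ) with hT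
  -- The affine map taking [cos α, 1] onto [-1, 1]. Its slope S⁻² explains the factor S^{2n}, which
  -- matches leading coefficients so that the degree of `p` drops below n.
  set L : Polynomial ℝ := Polynomial.C ((S ^ 2)⁻¹) * Polynomial.X +
    Polynomial.C (-(C ^ 2 / S ^ 2)) with hL
  have hTd : T.natDegree = n := by rw [hT, Polynomial.Chebyshev.natDegree_T]; simp
  have hS2 : (S ^ 2)⁻¹ ≠ 0 := by positivity
  have hLd : L.natDegree = 1 := Polynomial.natDegree_linear hS2
  have hLl : L.leadingCoeff = (S ^ 2)⁻¹ := Polynomial.leadingCoeff_linear hS2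
  have hcd : (T.comp L).natDegree = n := by rw [Polynomial.natDegree_comp, hTd, hLd, mul_one]
  have hcc : (T.comp L).coeff n = T.coeff n * ((S ^ 2)⁻¹) ^ n := by
    have h := Polynomial.leadingCoeff_comp (p := T) (q := L) (by rw [hLd]; exact one_ne_zero)
    rwa [Polynomial.leadingCoeff, hcd, hTd, hLl, Polynomial.leadingCoeff, hTd] at h
  set p := T - Polynomial.C (S ^ (2 * n)) * T.comp L with hp
  have hpd : p.natDegree ≤ n - 1 := by
    rw [Polynomial.natDegree_le_iff_coeff_eq_zero]
    intro N hN
    rcases Nat.lt_or_ge n N with h | h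
    · rw [hp, Polynomial.coeff_sub, Polynomial.coeff_C_mul,
        Polynomial.coeff_eq_zero_of_natDegree_lt (hTd.trans_lt h),
        Polynomial.coeff_eq_zero_of_natDegree_lt (hcd.trans_lt h)]
      simp
    · obtain rfl : N = n := by omega
      rw [hp, Polynomial.coeff_sub, Polynomial.coeff_C_mul, hcc, pow_mul, inv_pow]
      field_simp
      ring
  -- Since nc = kπ, the sign e = ±1 satisfies cos n(x - c) = e cos nx.
  set e : ℝ := Real.cos (k * Real.pi) with he
  have he2 : e ^ 2 = 1 := by
    have := Real.sin_sq_add_cos_sq (k * Real.pi)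
    rw [Real.sin_int_mul_pi] at this
    linarith
  have hea : |e| = 1 := by
    rw [← sq_eq_sq₀ (abs_nonneg _) zero_le_one, sq_abs, he2, one_pow]
  have hnc : n * c = k * Real.pi := by
    have : (n : ℝ) ≠ 0 := by positivity
    rw [hc]; field_simp
  refine ⟨e • fun t => p.eval (cosShift c 1 t),
    Submodule.smul_mem (trigSubmodule (n - 1)) e (eval_cosShift_mem_trigSubmodule c hpd), ?_⟩
  rintro _ ⟨x, hx, rfl⟩
  have hx' : |x - c| ≤ α := abs_le.2 ⟨by linarith [hx.1], by linarith [hx.2]⟩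
  set y := Real.cos (x - c) with hy
  have h1 : cosShift c 1 (x : Torus) = y := by rw [cosShift_coe]; simp [hy]
  have hTy : T.eval y = e * cosHarmonic n (x : Torus) := by
    rw [← h1, hT, eval_T_cosShift, cosShift, hnc, Real.sin_int_mul_pi]
    ring
  have hval : cosHarmonic n (x : Torus) - (e • fun t => p.eval (cosShift c 1 t)) (x : Torus) =
      e * (S ^ (2 * n) * T.eval ((y - C ^ 2) / S ^ 2)) := by
    have hLy : L.eval y = (y - C ^ 2) / S ^ 2 := by
      simp only [hL, Polynomial.eval_add, Polynomial.eval_mul, Polynomial.eval_C, Polynomial.eval_X]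
      ring
    simp only [Pi.smul_apply, smul_eq_mul, h1, hp, Polynomial.eval_sub, Polynomial.eval_mul,
      Polynomial.eval_C, Polynomial.eval_comp, hLy, hTy]
    linear_combination (-cosHarmonic n (x : Torus)) * he2
  change |cosHarmonic n (x : Torus) - (e • fun t => p.eval (cosShift c 1 t)) (x : Torus)| ≤ _
  rw [hval, abs_mul, hea, one_mul, abs_mul, abs_of_pos (pow_pos hs _)]
  refine mul_le_of_le_one_right (pow_pos hs _).le
    (Polynomial.Chebyshev.abs_eval_T_real_le_one _ ?_)
  have hy1 : y ≤ 1 := Real.cos_le_one _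
  have hy2 : Real.cos α ≤ y := by
    rw [hy, ← Real.cos_abs (x - c)]
    exact Real.cos_le_cos_of_nonneg_of_le_pi (abs_nonneg _) hαπ.le hx'
  rw [abs_le, le_div_iff₀ (by positivity), div_le_iff₀ (by positivity)]
  constructor <;> linarith

/-! ### Existence of a best approximation and conclusion. -/

theorem abs_le_uniformNormOn {Q : Set Torus} (hQ : IsCompact Q) {g : Torus → ℝ}
    (hg : Continuous g) {t : Torus} (ht : t ∈ Q) : |g t| ≤ uniformNormOn Q g := by
  have hb : BddAbove (Set.range fun s : Q => |g s|) := by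
    have := (hQ.image_of_continuousOn hg.abs.continuousOn).bddAbove
    rwa [Set.image_eq_range] at this
  exact le_ciSup hb (⟨t, ht⟩ : Q)

theorem uniformNormOn_nonneg (Q : Set Torus) (g : Torus → ℝ) : 0 ≤ uniformNormOn Q g :=
  Real.iSup_nonneg fun _ => abs_nonneg _

/-- The condition `0 ≤ M` covers an empty Q, where the real supremum is 0 by convention. -/
theorem bestApprox_le {n : ℕ} {Q : Set Torus} {f : Torus → ℝ} (hf : f ∈ trigPoly (n - 1)) {M : ℝ}
    (hM : 0 ≤ M) (h : ∀ t ∈ Q, |cosHarmonic n t - f t| ≤ M) : bestApprox n Q ≤ M := by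
  have hb : bestApprox n Q ≤ uniformNormOn Q fun t => cosHarmonic n t - f t := by
    refine csInf_le ⟨0, ?_⟩ ⟨f, hf, rfl⟩
    rintro _ ⟨g, -, rfl⟩
    exact uniformNormOn_nonneg _ _
  exact hb.trans (Real.iSup_le (fun t => h t t.2) hM)

theorem continuous_cosHarmonic_sub {n m : ℕ} {f : Torus → ℝ} (hf : f ∈ trigPoly m) :
    Continuous fun t => cosHarmonic n t - f t :=
  (continuous_cosHarmonic n).sub (continuous_of_mem_trigPoly hf)

/-- A best approximation exists. -/
theorem exists_eq_bestApprox (n : ℕ) {Q : Set Torus} (hQ : IsCompact Q) :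
    ∃ f ∈ trigPoly (n - 1), ∀ t ∈ Q, |cosHarmonic n t - f t| ≤ bestApprox n Q := by
  have : CompactSpace Q := isCompact_iff_compactSpace.1 hQ
  let ι : (k : ℕ) → C(Q, ℝ) := fun k => ⟨fun t => cosHarmonic k t, by
    exact (continuous_cosHarmonic k).comp continuous_subtype_val⟩
  let σ : (k : ℕ) → C(Q, ℝ) := fun k => ⟨fun t => sinHarmonic k t, by
    exact (continuous_sinHarmonic k).comp continuous_subtype_val⟩
  set A : Set C(Q, ℝ) := ι '' Set.Iic (n - 1) ∪ σ '' Set.Iic (n - 1) with hA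
  have hAfin : A.Finite := ((Set.finite_Iic _).image _).union ((Set.finite_Iic _).image _)
  set W := Submodule.span ℝ A with hW
  have hWfd : FiniteDimensional ℝ W := FiniteDimensional.span_of_finite ℝ hAfin
  have hWproper : ProperSpace W := FiniteDimensional.proper ℝ W
  have hto : ∀ w ∈ W, ∃ f ∈ trigSubmodule (n - 1), ∀ t : Q, w t = f t := by
    intro w hw
    induction hw using Submodule.span_induction with
    | mem x hx =>
      rcases hx with ⟨k, hk, rfl⟩ | ⟨k, hk, rfl⟩
      · exact ⟨_, cosHarmonic_mem_trigSubmodule hk, fun t => rfl⟩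
      · exact ⟨_, sinHarmonic_mem_trigSubmodule hk, fun t => rfl⟩
    | zero => exact ⟨0, Submodule.zero_mem _, fun t => rfl⟩
    | add x y _ _ hx hy =>
      obtain ⟨f, hf, h1⟩ := hx
      obtain ⟨g, hg, h2⟩ := hy
      exact ⟨f + g, Submodule.add_mem _ hf hg, fun t => by simp [h1, h2]⟩
    | smul c x _ hx =>
      obtain ⟨f, hf, h1⟩ := hx
      exact ⟨c • f, Submodule.smul_mem _ _ hf, fun t => by simp [h1]⟩
  have hfrom : ∀ f ∈ trigPoly (n - 1), ∃ w ∈ W, ∀ t : Q, w t = f t := by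
    rintro f ⟨a, b, hf⟩
    refine ⟨(a 0 / 2) • ι 0 + ∑ k ∈ Finset.Icc 1 (n - 1), (a k • ι k + b k • σ k),
      Submodule.add_mem _ (Submodule.smul_mem _ _ (Submodule.subset_span
        (Or.inl ⟨0, Nat.zero_le _, rfl⟩))) (Submodule.sum_mem _ fun k hk => ?_), fun t => ?_⟩
    · rw [Finset.mem_Icc] at hk
      exact Submodule.add_mem _
        (Submodule.smul_mem _ _ (Submodule.subset_span (Or.inl ⟨k, hk.2, rfl⟩)))
        (Submodule.smul_mem _ _ (Submodule.subset_span (Or.inr ⟨k, hk.2, rfl⟩)))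
    · rw [hf t]
      simp [ι, σ, cosHarmonic_zero, ContinuousMap.sum_apply]
  have hnorm : ∀ (w : C(Q, ℝ)) (f : Torus → ℝ), (∀ t : Q, w t = f t) →
      ‖ι n - w‖ = uniformNormOn Q fun t => cosHarmonic n t - f t := by
    intro w f h
    rw [ContinuousMap.norm_eq_iSup_norm, uniformNormOn]
    refine iSup_congr fun t => ?_
    rw [ContinuousMap.sub_apply, h t, Real.norm_eq_abs]
    rfl
  -- The span is finite-dimensional, hence proper, and an element of norm at least 2‖`ι n`‖
  -- approximates no better than 0, so the minimum is attained.
  obtain ⟨⟨w, hw⟩, hmin⟩ := Continuous.exists_forall_le' (f := fun w : W => ‖ι n - w‖)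
    (by fun_prop) 0 (by
      filter_upwards [(tendsto_norm_cocompact_atTop (E := W)).eventually_ge_atTop (2 * ‖ι n‖)]
        with w hw
      have h1 := norm_sub_norm_le (w : C(Q, ℝ)) (ι n)
      rw [norm_sub_rev] at h1
      have h2 : ‖(w : C(Q, ℝ))‖ = ‖w‖ := rfl
      simp only [Submodule.coe_zero, sub_zero]
      linarith)
  obtain ⟨f, hf, hwf⟩ := hto w hw
  refine ⟨f, hf, fun t ht => ?_⟩
  refine (abs_le_uniformNormOn hQ (continuous_cosHarmonic_sub (n := n) hf) ht).trans ?_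
  refine le_csInf ⟨_, ⟨f, hf, rfl⟩⟩ ?_
  rintro _ ⟨g, hg, rfl⟩
  obtain ⟨v, hv, hvg⟩ := hfrom g hg
  have := hmin ⟨v, hv⟩
  simp only at this
  rwa [hnorm w f hwf, hnorm v g hvg] at this

theorem sin_pow_le_bestApprox {n : ℕ} (hn : 1 ≤ n) {α : ℝ} (hα0 : 0 < α) (hαπ : α < Real.pi)
    {Q : Set Torus} (hQ : IsCompact Q) (hvol : volume Q = ENNReal.ofReal (2 * α)) :
    Real.sin (α / 2) ^ (2 * n) ≤ bestApprox n Q := by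
  obtain ⟨f, hf, hF⟩ := exists_eq_bestApprox n hQ
  have h0 : 0 ≤ bestApprox n Q := by
    obtain ⟨t, ht⟩ := nonempty_of_volume hα0 hvol
    exact (abs_nonneg _).trans (hF t ht)
  -- The constant term (Mzⁿ)² is used with M > 0, so the estimate is applied to the best value plus
  -- ε.
  refine le_of_forall_pos_le_add fun ε hε => ?_
  exact sin_pow_le_of_abs_le hn hα0 hαπ hQ hvol hf (by linarith)
    fun t ht => (hF t ht).trans (by linarith)

end

theorem theorem8 (n : ℕ) (hn : 1 ≤ n) (α : ℝ) (hα0 : 0 < α) (hαπ : α < Real.pi) :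
    (∀ Q : Set Torus, IsCompact Q → volume Q = ENNReal.ofReal (2 * α) →
      Real.sin (α / 2) ^ (2 * n) ≤ bestApprox n Q ∧
      (bestApprox n Q = Real.sin (α / 2) ^ (2 * n) ↔ ∃ k : ℤ, Q = torusSegment n α k)) ∧
    leastBestApprox n (2 * α) = Real.sin (α / 2) ^ (2 * n) := by
  have hle : ∀ k : ℤ, bestApprox n (torusSegment n α k) ≤ Real.sin (α / 2) ^ (2 * n) := by
    intro k
    obtain ⟨f, hf, h⟩ := exists_trigPoly_le_of_torusSegment hn hα0 hαπ k
    exact bestApprox_le hf (pow_pos (sin_half_pos hα0 hαπ) _).le h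
  refine ⟨fun Q hQ hvol => ⟨sin_pow_le_bestApprox hn hα0 hαπ hQ hvol, fun h => ?_, ?_⟩, ?_⟩
  · obtain ⟨f, hf, hF⟩ := exists_eq_bestApprox n hQ
    exact eq_torusSegment_of_eq hn hα0 hαπ hQ hvol hf (h ▸ hF)
  · rintro ⟨k, rfl⟩
    exact le_antisymm (hle k) (sin_pow_le_bestApprox hn hα0 hαπ hQ hvol)
  · refine IsLeast.csInf_eq ⟨⟨torusSegment n α 0, ⟨isCompact_torusSegment n α 0,
      volume_torusSegment n hαπ 0⟩, le_antisymm (hle 0) ?_⟩, ?_⟩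
    · exact sin_pow_le_bestApprox hn hα0 hαπ (isCompact_torusSegment n α 0)
        (volume_torusSegment n hαπ 0)
    · rintro _ ⟨Q, ⟨hQ, hvol⟩, rfl⟩
      exact sin_pow_le_bestApprox hn hα0 hαπ hQ hvol
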